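/- **FKG inequality and monotonicity for the $\varphi^4$ random cluster measure.** *Setting.* Fix $d\in\mathbb N$, $g>0$, $a\in\mathbb R$, write $\mathbb R^+=[0,\infty)$, and let $\rho_{g,a}$ be the probability measure on $\mathbb R$ with density proportional to $e^{-gt^4-at^2}$. Let $\Lambda\subset\mathbb Z^d$ be finite, $\partial^{\rm ext}\Lambda$ the set of $x\notin\Lambda$ with a nearest neighbour in $\Lambda$, $\overline\Lambda=\Lambda\sqcup\partial^{\rm ext}\Lambda$, and $\overline E(\Lambda)$ the set of nearest-neighbour edges of $\mathbb Z^d$ with at least one endpoint in $\Lambda$. Let $\mathfrak g$ be an additional (ghost) vertex. For $\beta\ge 0$, an external field $\mathsf h\in(\mathbb R^+)^\Lambda$ and a boundary condition $(\xi,\mathsf b)$, where $\xi$ is a partition of $\partial^{\rm ext}\Lambda$ and $\mathsf b\in(\mathbb R^+)^{\partial^{\rm ext}\Lambda}$, the $\varphi^4$ random cluster measure $\Psi^{(\xi,\mathsf b)}_{\Lambda,\beta,\mathsf h}$ is the probability measure on pairs $(\omega,\mathsf a)$, with $\omega\in\{0,1\}^{\overline E(\Lambda)\,\cup\,\{x\mathfrak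 g:\,x\in\Lambda\}}$ and $\mathsf a\in(\mathbb R^+)^{\overline\Lambda}$ satisfying $\mathsf a|_{\partial^{\rm ext}\Lambda}=\mathsf b$, given by $$\mathrm d\Psi^{(\xi,\mathsf b)}_{\Lambda,\beta,\mathsf h}[(\omega,\mathsf a)]=\frac{\mathbf 1_{\mathsf a|_{\partial^{\rm ext}\Lambda}=\mathsf b}}{Z}\prod_{e\in\overline E(\Lambda)}\sqrt{1-p_e}\Big(\frac{p_e}{1-p_e}\Big)^{\omega_e}\prod_{x\in\Lambda}\sqrt{1-p_{x\mathfrak g}}\Big(\frac{p_{x\mathfrak g}}{1-p_{x\mathfrak g}}\Big)^{\omega_{x\mathfrak g}}\,2^{k^\xi(\omega)}\prod_{x\in\Lambda}\mathrm d|\rho_{g,a}|(\mathsf a_x),$$ where $p_{xy}=1-e^{-2\beta\mathsf a_x\mathsf a_y}$, $p_{x\mathfrak g}=1-e^{-2\beta\mathsf h_x\mathsf a_x}$, $0^0=1$, $|\rho_{g,a}|$ is the image of $\rho_{g,a}$ under $t\mapsto|t|$, $k^\xi(\omega)$ is the number of connected components of the graph on $\overline\Lambda\cup\{\mathfrak g\}$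 formed by the open edges of $\omega$ after identifying the vertices in each class of $\xi$, and $Z$ is the normalising constant. (An edge $x\mathfrak g$ with $\mathsf h_x=0$ is almost surely closed.) For $A\subset\Lambda$ and $\eta\in(\mathbb R^+)^A$, let $\Psi^{(\xi,\mathsf b)}_{\Lambda,\beta,\mathsf h}[\,\cdot\mid\mathsf a|_A=\eta]$ be the probability measure with the same density, renormalised, in which $\mathsf a_x$ is fixed to $\eta_x$ for $x\in A$ (the factors $\mathrm d|\rho_{g,a}|(\mathsf a_x)$, $x\in A$, being replaced by Dirac masses at $\eta_x$). "Increasing" refers to the coordinatewise order on pairs $(\omega,\mathsf a)$. *Statement.* 1. For all $\beta\ge0$, $\mathsf h$ and $(\xi,\mathsf b)$, the probability measure $\Psi=\Psi^{(\xi,\mathsf b)}_{\Lambda,\beta,\mathsf h}$ is well defined and, for all increasing square-integrable functions $F,G$ of $(\omega,\mathsf a)$, $$\Psi[F\,G]\ \ge\ \Psi[F]\,\Psi[G].$$ Moreover, for every $A\subset\Lambda$, the family $\Psi[\,\cdot\mid\mathsf a|_A=\eta]$, $\eta\in(\mathbb R^+)^A$, consists of well-defined probability measures and is a regular conditional law of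 $(\omega,\mathsf a)$ given $\mathsf a|_A$ under $\Psi$; and for every $\eta\in(\mathbb R^+)^A$ and all increasing functions $F,G$ that are square-integrable for $\Psi[\,\cdot\mid\mathsf a|_A=\eta]$, $$\Psi[F\,G\mid\mathsf a|_A=\eta]\ \ge\ \Psi[F\mid\mathsf a|_A=\eta]\ \Psi[G\mid\mathsf a|_A=\eta].$$ 2. Let $0\le\beta_1\le\beta_2$, $\mathsf h_1\le\mathsf h_2$, $\mathsf b_1\le\mathsf b_2$, and let every class of $\xi_1$ be contained in a class of $\xi_2$. Then $$\Psi^{(\xi_1,\mathsf b_1)}_{\Lambda,\beta_1,\mathsf h_1}[F]\le\Psi^{(\xi_2,\mathsf b_2)}_{\Lambda,\beta_2,\mathsf h_2}[F]$$ for every increasing $F$ that is integrable for both measures. More generally, for every $A\subset\Lambda$ and all $\eta_1\le\eta_2$ in $(\mathbb R^+)^A$, $$\Psi^{(\xi_1,\mathsf b_1)}_{\Lambda,\beta_1,\mathsf h_1}[F\mid\mathsf a|_A=\eta_1]\le\Psi^{(\xi_2,\mathsf b_2)}_{\Lambda,\beta_2,\mathsf h_2}[F\mid\mathsf a|_A=\eta_2]$$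 for every increasing $F$ that is integrable for both conditional measures. -/

import Mathlib

open MeasureTheory
open scoped NNReal ENNReal

noncomputable section

namespace Phi4RC

/-! ### The lattice, a finite volume and its exterior boundary -/

/-- The nearest-neighbour graph on `ℤ^d`. -/
def lattice (d : ℕ) : SimpleGraph (Fin d → ℤ) where
  Adj x y := ∑ i, |x i - y i| = 1
  symm := ⟨fun x y h => by simpa only [abs_sub_comm] using h⟩
  loopless := ⟨fun x h => by simp at h⟩

theorem mem_Icc_of_adj {d : ℕ} {x y : Fin d → ℤ} (h : (lattice d).Adj x y) :
    x ∈ Finset.Icc (y - 1) (y + 1) := by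
  have h1 : ∀ i, |x i - y i| ≤ 1 := fun i => by
    have h2 : ∑ j, |x j - y j| = 1 := h
    rw [← h2]
    exact Finset.single_le_sum (f := fun j => |x j - y j|)
      (fun j _ => abs_nonneg _) (Finset.mem_univ i)
  rw [Finset.mem_Icc]
  refine ⟨fun i => ?_, fun i => ?_⟩ <;> have := abs_le.1 (h1 i) <;>
    simp only [Pi.sub_apply, Pi.add_apply, Pi.one_apply] <;> omega

variable {d : ℕ}

open Classical in
/-- The exterior boundary `∂ᵉˣᵗ Λ`: the vertices outside `Λ` with a neighbour in `Λ`. -/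
def extBoundary (Λ : Finset (Fin d → ℤ)) : Finset (Fin d → ℤ) :=
  (Λ.biUnion fun y => Finset.Icc (y - 1) (y + 1)).filter
    fun x => x ∉ Λ ∧ ∃ y ∈ Λ, (lattice d).Adj x y

theorem mem_extBoundary {Λ : Finset (Fin d → ℤ)} {x : Fin d → ℤ} :
    x ∈ extBoundary Λ ↔ x ∉ Λ ∧ ∃ y ∈ Λ, (lattice d).Adj x y := by
  classical
  simp only [extBoundary, Finset.mem_filter, Finset.mem_biUnion, and_iff_right_iff_imp]
  rintro ⟨-, y, hy, h⟩
  exact ⟨y, hy, mem_Icc_of_adj h⟩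

/-- `Λ̄ = Λ ⊔ ∂ᵉˣᵗ Λ`. -/
def closedVolume (Λ : Finset (Fin d → ℤ)) : Finset (Fin d → ℤ) := Λ ∪ extBoundary Λ

theorem mem_closedVolume_of_mem {Λ : Finset (Fin d → ℤ)} {x : Fin d → ℤ} (hx : x ∈ Λ) :
    x ∈ closedVolume Λ := Finset.mem_union_left _ hx

theorem mem_extBoundary_of_notMem {Λ : Finset (Fin d → ℤ)} {x : Fin d → ℤ}
    (hx : x ∈ closedVolume Λ) (h : x ∉ Λ) : x ∈ extBoundary Λ :=
  (Finset.mem_union.1 hx).resolve_left h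

open Classical in
/-- `Ē(Λ)`: the edges of `ℤ^d` with at least one endpoint in `Λ` (both endpoints then lie
in `Λ̄`). -/
def edges (Λ : Finset (Fin d → ℤ)) : Finset (Sym2 (closedVolume Λ)) :=
  Finset.univ.filter fun e =>
    e.map Subtype.val ∈ (lattice d).edgeSet ∧ ∃ x ∈ e, (x : Fin d → ℤ) ∈ Λ

/-! ### Configurations -/

/-- Percolation configurations: `ω (Sum.inl e)` is the state of `e ∈ Ē(Λ)` and
`ω (Sum.inr x)` the state of the edge from `x ∈ Λ` to the ghost `𝔤`. One space serves all
fields `h`: where `h x = 0` the graph has no edge `x𝔤`, and correspondingly the weight below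
vanishes as soon as `ω (Sum.inr x) = true`. -/
abbrev Config (Λ : Finset (Fin d → ℤ)) : Type := (edges Λ ⊕ Λ) → Bool

/-- Absolute value fields on `Λ̄`. -/
abbrev AbsField (Λ : Finset (Fin d → ℤ)) : Type := closedVolume Λ → ℝ≥0

/-- Elementary connections on `Λ̄ ∪ {𝔤}` (with `𝔤 = none`): open edges, and pairs of boundary
vertices in the same class of the partition `ξ`. -/
def Joined {Λ : Finset (Fin d → ℤ)} (ξ : Setoid (extBoundary Λ)) (ω : Config Λ) :
    Option (closedVolume Λ) → Option (closedVolume Λ) → Prop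
  | some x, some y =>
      (∃ e : edges Λ, (e : Sym2 (closedVolume Λ)) = s(x, y) ∧ ω (Sum.inl e) = true) ∨
        ∃ (hx : (x : Fin d → ℤ) ∈ extBoundary Λ) (hy : (y : Fin d → ℤ) ∈ extBoundary Λ),
          ξ ⟨x, hx⟩ ⟨y, hy⟩
  | some x, none => ∃ hx : (x : Fin d → ℤ) ∈ Λ, ω (Sum.inr ⟨x, hx⟩) = true
  | none, _ => False

/-- `k^ξ(ω)`: the number of connected components of the open graph on `Λ̄ ∪ {𝔤}` after
identifying the vertices in each class of `ξ`. -/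
def numClusters {Λ : Finset (Fin d → ℤ)} (ξ : Setoid (extBoundary Λ)) (ω : Config Λ) : ℕ :=
  Nat.card (Quotient (Relation.EqvGen.setoid (Joined ξ ω)))

/-! ### The single-site measure -/

/-- The finite measure `μ` divided by its total mass. -/
def normalize {X : Type*} [MeasurableSpace X] (μ : Measure X) : Measure X :=
  (μ Set.univ)⁻¹ • μ

/-- `dρ_{g,a}(t) = z⁻¹ exp (-g t⁴ - a t²) dt` on `ℝ`. -/
def singleSite (g a : ℝ) : Measure ℝ :=
  normalize (volume.withDensity fun t => ENNReal.ofReal (Real.exp (-g * t ^ 4 - a * t ^ 2)))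

/-- The law of `|t|` for `t` distributed according to `ρ_{g,a}`. -/
def absSingleSite (g a : ℝ) : Measure ℝ≥0 :=
  (singleSite g a).map fun t => Real.nnabs t

/-! ### The random cluster measure -/

/-- `p(β, s)_{xy} = 1 - exp (-2 β s_x s_y)`. -/
def edgeProb {Λ : Finset (Fin d → ℤ)} (β : ℝ) (s : AbsField Λ) (e : Sym2 (closedVolume Λ)) : ℝ :=
  1 - Real.exp (-2 * β * ((e.map s).mul : ℝ≥0))

/-- `p(β, h, s)_{x𝔤} = 1 - exp (-2 β h_x s_x)`. -/
def ghostProb {Λ : Finset (Fin d → ℤ)} (β : ℝ) (h : Λ → ℝ≥0) (s : AbsField Λ) (x : Λ) : ℝ :=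
  1 - Real.exp (-2 * β * h x * s ⟨x, mem_closedVolume_of_mem x.2⟩)

/-- The factor `√(1 - p) (p / (1 - p)) ^ ω` of an edge with parameter `p` in state `o`. -/
def edgeFactor (p : ℝ) (o : Bool) : ℝ := √(1 - p) * (p / (1 - p)) ^ o.toNat

/-- The density of the (unnormalised) random cluster measure. -/
def weight {Λ : Finset (Fin d → ℤ)} (β : ℝ) (h : Λ → ℝ≥0) (ξ : Setoid (extBoundary Λ))
    (q : Config Λ × AbsField Λ) : ℝ :=
  (∏ e : edges Λ, edgeFactor (edgeProb β q.2 e) (q.1 (Sum.inl e))) *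
    (∏ x : Λ, edgeFactor (ghostProb β h q.2 x) (q.1 (Sum.inr x))) *
    2 ^ numClusters ξ q.1

/-- The reference measure for the field: independent sites, with law `|·|_* ρ_{g,a}` in `Λ`
and with the prescribed value `b` on `∂ᵉˣᵗ Λ`. -/
def fieldRef (g a : ℝ) {Λ : Finset (Fin d → ℤ)} (b : extBoundary Λ → ℝ≥0) :
    Measure (AbsField Λ) :=
  open Classical in
  Measure.pi fun x : closedVolume Λ =>
    if hx : (x : Fin d → ℤ) ∈ Λ then absSingleSite g a
    else Measure.dirac (b ⟨x, mem_extBoundary_of_notMem x.2 hx⟩)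

/-- The reference measure when moreover the field is set equal to `η` on `A`. -/
def fieldRefGiven (g a : ℝ) {Λ : Finset (Fin d → ℤ)} (b : extBoundary Λ → ℝ≥0)
    (A : Finset (Fin d → ℤ)) (η : A → ℝ≥0) : Measure (AbsField Λ) :=
  open Classical in
  Measure.pi fun x : closedVolume Λ =>
    if hA : (x : Fin d → ℤ) ∈ A then Measure.dirac (η ⟨x, hA⟩)
    else if hx : (x : Fin d → ℤ) ∈ Λ then absSingleSite g a
    else Measure.dirac (b ⟨x, mem_extBoundary_of_notMem x.2 hx⟩)

/-- The `φ⁴` random cluster measure `Ψ^{(ξ,b)}_{Λ,β,h}`, a measure on pairs `(ω, s)`. -/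
def phi4RC (g a : ℝ) {Λ : Finset (Fin d → ℤ)} (β : ℝ) (h : Λ → ℝ≥0)
    (ξ : Setoid (extBoundary Λ)) (b : extBoundary Λ → ℝ≥0) : Measure (Config Λ × AbsField Λ) :=
  normalize ((Measure.count.prod (fieldRef g a b)).withDensity
    fun q => ENNReal.ofReal (weight β h ξ q))

/-- The conditional measure `Ψ^{(ξ,b)}_{Λ,β,h}[ · | s|_A = η]`, in the version which is given
by the same density for every `η`. -/
def phi4RCGiven (g a : ℝ) {Λ : Finset (Fin d → ℤ)} (β : ℝ) (h : Λ → ℝ≥0)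
    (ξ : Setoid (extBoundary Λ)) (b : extBoundary Λ → ℝ≥0)
    (A : Finset (Fin d → ℤ)) (η : A → ℝ≥0) : Measure (Config Λ × AbsField Λ) :=
  normalize ((Measure.count.prod (fieldRefGiven g a b A η)).withDensity
    fun q => ENNReal.ofReal (weight β h ξ q))

/-- The observable `(ω, s) ↦ s|_A`. -/
def fieldOn {Λ A : Finset (Fin d → ℤ)} (hA : A ⊆ Λ) (q : Config Λ × AbsField Λ) : A → ℝ≥0 :=
  fun x => q.2 ⟨x, mem_closedVolume_of_mem (hA x.2)⟩

/-! ### Conditional laws, positive association, stochastic domination -/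

/-- `κ` is a regular conditional law `κ t = μ[ · | Y = t]` of `μ` given `Y`. -/
structure IsRegularCondLaw {X T : Type*} [MeasurableSpace X] [MeasurableSpace T]
    (μ : Measure X) (Y : X → T) (κ : T → Measure X) : Prop where
  measurable : Measurable κ
  prob : ∀ t, IsProbabilityMeasure (κ t)
  concentrated : ∀ t, κ t {q | Y q ≠ t} = 0
  disintegration : ∀ E : Set X, MeasurableSet E → ∀ S : Set T, MeasurableSet S →
    μ (E ∩ Y ⁻¹' S) = ∫⁻ q in Y ⁻¹' S, κ (Y q) E ∂μ

/-- The FKG inequality for all increasing square-integrable functions. -/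
def HasFKG {X : Type*} [MeasurableSpace X] [Preorder X] (μ : Measure X) : Prop :=
  ∀ F G : X → ℝ, Monotone F → Monotone G → MemLp F 2 μ → MemLp G 2 μ →
    (∫ q, F q ∂μ) * ∫ q, G q ∂μ ≤ ∫ q, F q * G q ∂μ

/-- Stochastic domination `μ ≼ ν`, tested on all increasing functions integrable for both
measures. -/
def StochDom {X : Type*} [MeasurableSpace X] [Preorder X] (μ ν : Measure X) : Prop :=
  ∀ F : X → ℝ, Monotone F → Integrable F μ → Integrable F ν →
    ∫ q, F q ∂μ ≤ ∫ q, F q ∂ν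

end Phi4RC

end

/-! Everything follows from one inequality, `Correlated`: for nonnegative increasing F, G and
ordered parameters, Ψ₁[F] Ψ₂[G] ≤ Ψ₂[F G]. Equal parameters give FKG, and G = 1 gives stochastic
domination; truncation from below and a shift remove the sign condition.

The measure has two levels. For a fixed field s, ω is a random cluster model with couplings J(s).
Writing 2^k as the number of compatible ±1 spins turns its lattice condition into an inequality
between indices of subgroups (`card_satisfying_mul_le`), and the discrete four functions theorem
gives Holley and FKG inequalities for ω.

The field has density Z(s) = ∑_ω weight with respect to a product measure. By Edwards–Sokal, Z is an
Ising partition function. The condition Z₁(s) Z₂(t) ≤ Z₁(s ⊓ t) Z₂(s ⊔ t) comes from Ginibre's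
duplication: substituting σ = θτ writes a product of partition functions with couplings A and B as a
sum over θ of partition functions with couplings B ± A, which Griffiths' first inequality compares
(`sum_rcWeight_mul_le`).

Together the levels give the hypothesis of a continuous four functions theorem for the field
(`sum_mul_weight_mul_le_sup`), proved by induction on the number of sites (`fourFunctions_pi`).
Fields with prescribed values are images of one free product field under `overwrite`, so all the
measures are compared over a common space; A = ∅ is the unconditioned case. -/

namespace Phi4RC

/-! ### Random cluster weights over a finite group of spins -/

section Spins

variable {Γ I : Type*} [CommGroup Γ]

/-- The spin configurations in `G` for which every open edge is satisfied. -/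
def satisfying (χ : I → Γ →* ℤˣ) (G : Subgroup Γ) (ω : I → Bool) : Subgroup Γ :=
  G ⊓ ⨅ i, ⨅ _ : ω i = true, (χ i).ker

theorem mem_satisfying {χ : I → Γ →* ℤˣ} {G : Subgroup Γ} {ω : I → Bool} {σ : Γ} :
    σ ∈ satisfying χ G ω ↔ σ ∈ G ∧ ∀ i, ω i = true → χ i σ = 1 := by
  simp [satisfying, Subgroup.mem_iInf, MonoidHom.mem_ker]

/-- The factor of an edge with coupling constant `J` in state `o`. -/
noncomputable def bondFactor (J : ℝ) (o : Bool) : ℝ :=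
  if o then Real.exp J - Real.exp (-J) else Real.exp (-J)

theorem bondFactor_nonneg {J : ℝ} (hJ : 0 ≤ J) (o : Bool) : 0 ≤ bondFactor J o := by
  unfold bondFactor
  split_ifs
  · exact sub_nonneg.2 (Real.exp_le_exp.2 (by linarith))
  · positivity

/-- Equality except for o open and o' closed, where the claim reduces to exp (J - K) ≤ exp (K - J).
-/
theorem bondFactor_mul_le {J K : ℝ} (hJK : J ≤ K) (o o' : Bool) :
    bondFactor J o * bondFactor K o' ≤ bondFactor J (o ⊓ o') * bondFactor K (o ⊔ o') := by
  cases o <;> cases o' <;> simp only [bondFactor, Bool.inf_eq_band, Bool.sup_eq_bor,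
    Bool.and_true, Bool.and_false, Bool.or_true, Bool.or_false, le_refl]
  simp only [if_true, Bool.false_eq_true, if_false]
  have h1 : Real.exp J * Real.exp (-J) = 1 := by rw [← Real.exp_add]; simp
  have h2 : Real.exp K * Real.exp (-K) = 1 := by rw [← Real.exp_add]; simp
  have h3 : Real.exp J ≤ Real.exp K := Real.exp_le_exp.2 hJK
  have h4 : Real.exp (-K) ≤ Real.exp (-J) := Real.exp_le_exp.2 (by linarith)
  have h5 : Real.exp J * Real.exp (-K) ≤ Real.exp (-J) * Real.exp K := by
    rw [mul_comm (Real.exp (-J))]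
    exact mul_le_mul h3 h4 (by positivity) (by positivity)
  nlinarith

/-- Closing edges enlarges the group and opening edges intersects groups, so the claim reads |H| |K|
≤ |L| |H ∩ K| for subgroups H, K of L. Equivalently [K : H ∩ K] ≤ [L : H]: distinct cosets of H ∩ K
in K lie in distinct cosets of H in L. -/
theorem card_satisfying_mul_le [Finite Γ] (χ : I → Γ →* ℤˣ) {G₁ G₂ : Subgroup Γ} (hG : G₂ ≤ G₁)
    (ω ω' : I → Bool) :
    Nat.card (satisfying χ G₁ ω) * Nat.card (satisfying χ G₂ ω') ≤
      Nat.card (satisfying χ G₁ (ω ⊓ ω')) * Nat.card (satisfying χ G₂ (ω ⊔ ω')) := by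
  set H := satisfying χ G₁ ω with hH
  set K := satisfying χ G₂ ω' with hK
  set L := satisfying χ G₁ (ω ⊓ ω') with hL
  have hHL : H ≤ L := fun σ hσ => by
    rw [hH, mem_satisfying] at hσ
    rw [hL, mem_satisfying]
    refine ⟨hσ.1, fun i hi => hσ.2 i ?_⟩
    simp only [Pi.inf_apply, Bool.inf_eq_band, Bool.and_eq_true] at hi
    exact hi.1
  have hKL : K ≤ L := fun σ hσ => by
    rw [hK, mem_satisfying] at hσ
    rw [hL, mem_satisfying]
    refine ⟨hG hσ.1, fun i hi => hσ.2 i ?_⟩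
    simp only [Pi.inf_apply, Bool.inf_eq_band, Bool.and_eq_true] at hi
    exact hi.2
  have hinf : satisfying χ G₂ (ω ⊔ ω') = H ⊓ K := by
    ext σ
    rw [Subgroup.mem_inf, hH, hK]
    simp only [mem_satisfying, Pi.sup_apply, Bool.sup_eq_bor, Bool.or_eq_true]
    exact ⟨fun h => ⟨⟨hG h.1, fun i hi => h.2 i (.inl hi)⟩, h.1, fun i hi => h.2 i (.inr hi)⟩,
      fun h => ⟨h.2.1, fun i hi => hi.elim (h.1.2 i) (h.2.2 i)⟩⟩
  rw [hinf]
  have h1 := Subgroup.relIndex_mul_relIndex ⊥ H L bot_le hHL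
  have h2 := Subgroup.relIndex_mul_relIndex ⊥ (H ⊓ K) K bot_le inf_le_right
  rw [Subgroup.inf_relIndex_right] at h2
  simp only [Subgroup.relIndex_bot_left] at h1 h2
  have h3 : H.relIndex K ≤ H.relIndex L :=
    Subgroup.relIndex_le_of_le_right hKL fun h0 => by
      rw [h0, mul_zero] at h1
      exact Nat.card_pos.ne h1
  rw [← h1, ← h2]
  calc _ = Nat.card H * Nat.card ↥(H ⊓ K) * H.relIndex K := by ring
    _ ≤ Nat.card H * Nat.card ↥(H ⊓ K) * H.relIndex L := Nat.mul_le_mul_left _ h3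
    _ = _ := by ring

variable [Fintype I]

/-- The random cluster weight of `ω`, with one factor for each compatible spin configuration. -/
noncomputable def rcWeight (χ : I → Γ →* ℤˣ) (G : Subgroup Γ) (J : I → ℝ) (ω : I → Bool) : ℝ :=
  (∏ i, bondFactor (J i) (ω i)) * Nat.card (satisfying χ G ω)

theorem rcWeight_nonneg (χ : I → Γ →* ℤˣ) (G : Subgroup Γ) {J : I → ℝ} (hJ : 0 ≤ J)
    (ω : I → Bool) : 0 ≤ rcWeight χ G J ω :=
  mul_nonneg (Finset.prod_nonneg fun i _ => bondFactor_nonneg (hJ i) _) (Nat.cast_nonneg _)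

theorem rcWeight_mul_le [Finite Γ] (χ : I → Γ →* ℤˣ) {G₁ G₂ : Subgroup Γ} (hG : G₂ ≤ G₁) {J K : I → ℝ}
    (hJ : 0 ≤ J) (hJK : J ≤ K) (ω ω' : I → Bool) :
    rcWeight χ G₁ J ω * rcWeight χ G₂ K ω' ≤
      rcWeight χ G₁ J (ω ⊓ ω') * rcWeight χ G₂ K (ω ⊔ ω') := by
  have h1 : (∏ i, bondFactor (J i) (ω i)) * (∏ i, bondFactor (K i) (ω' i)) ≤
      (∏ i, bondFactor (J i) ((ω ⊓ ω') i)) * (∏ i, bondFactor (K i) ((ω ⊔ ω') i)) := by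
    rw [← Finset.prod_mul_distrib, ← Finset.prod_mul_distrib]
    exact Finset.prod_le_prod (fun i _ => mul_nonneg (bondFactor_nonneg (hJ i) _)
      (bondFactor_nonneg ((hJ i).trans (hJK i)) _))
      fun i _ => bondFactor_mul_le (hJK i) _ _
  have h2 : (Nat.card (satisfying χ G₁ ω) * Nat.card (satisfying χ G₂ ω') : ℝ) ≤
      Nat.card (satisfying χ G₁ (ω ⊓ ω')) * Nat.card (satisfying χ G₂ (ω ⊔ ω')) := by
    exact_mod_cast card_satisfying_mul_le χ hG ω ω'
  have h3 := mul_le_mul h1 h2 (by positivity) (mul_nonneg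
    (Finset.prod_nonneg fun i _ => bondFactor_nonneg (hJ i) _)
    (Finset.prod_nonneg fun i _ => bondFactor_nonneg ((hJ i).trans (hJK i)) _))
  simp only [rcWeight]
  calc _ = _ := by ring
    _ ≤ _ := h3
    _ = _ := by ring

end Spins

/-! ### Partition functions: Edwards–Sokal, Griffiths and Ginibre -/

section Partition

variable {Γ I : Type*} [CommGroup Γ] [Fintype Γ] [Fintype I] [DecidableEq I]

/-- The value `±1` of a character as a real number. -/
noncomputable def realChar (f : Γ →* ℤˣ) : Γ →* ℝ :=
  (Int.castRingHom ℝ).toMonoidHom.comp ((Units.coeHom ℤ).comp f)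

omit [Fintype Γ] in
theorem realChar_apply (f : Γ →* ℤˣ) (σ : Γ) : realChar f σ = ((f σ : ℤ) : ℝ) := rfl

omit [Fintype Γ] in
theorem realChar_eq_or (f : Γ →* ℤˣ) (σ : Γ) :
    (f σ = 1 ∧ realChar f σ = 1) ∨ (f σ ≠ 1 ∧ realChar f σ = -1) := by
  rw [realChar_apply]
  rcases Int.units_eq_one_or (f σ) with h | h <;> simp [h]

-- A satisfied edge may be open or closed, with total factor exp J; an unsatisfied edge must be
-- closed, with factor exp (-J).
omit [Fintype Γ] in
open Classical in
theorem sum_bool_eq {f : Γ →* ℤˣ} (J : ℝ) (σ : Γ) :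
    (∑ o : Bool, bondFactor J o * if o = true → f σ = 1 then 1 else 0) =
      Real.exp (J * realChar f σ) := by
  rcases realChar_eq_or f σ with ⟨h, h'⟩ | ⟨h, h'⟩ <;> simp [bondFactor, h, h']

open Classical in
/-- The Edwards–Sokal identity: the partition function as a sum over spins. -/
theorem sum_rcWeight (χ : I → Γ →* ℤˣ) (G : Subgroup Γ) (J : I → ℝ) :
    ∑ ω, rcWeight χ G J ω = ∑ σ : G, ∏ i, Real.exp (J i * realChar (χ i) σ) := by
  have h1 : ∀ ω : I → Bool, (Nat.card (satisfying χ G ω) : ℝ) =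
      ∑ σ : G, ∏ i, if ω i = true → χ i σ = 1 then (1 : ℝ) else 0 := fun ω => by
    have : ∀ σ : G, (∏ i, if ω i = true → χ i σ = 1 then (1 : ℝ) else 0) =
        if ∀ i, ω i = true → χ i σ = 1 then 1 else 0 := fun σ => by
      rw [Finset.prod_ite_zero]; simp
    simp_rw [this]
    rw [Finset.sum_boole, ← Fintype.card_subtype, ← Nat.card_eq_fintype_card]
    congr 1
    refine Nat.card_congr ⟨fun σ => ⟨⟨σ, (mem_satisfying.1 σ.2).1⟩, (mem_satisfying.1 σ.2).2⟩,
      fun σ => ⟨σ.1, mem_satisfying.2 ⟨σ.1.2, σ.2⟩⟩, fun _ => rfl, fun _ => rfl⟩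
  simp_rw [rcWeight, h1, Finset.mul_sum, ← Finset.prod_mul_distrib, ← sum_bool_eq]
  rw [Finset.sum_comm]
  refine Finset.sum_congr rfl fun σ _ => ?_
  -- Once the spins are fixed, the sum over ω factorises over the edges.
  rw [Finset.prod_univ_sum, Fintype.piFinset_univ]

theorem sum_rcWeight_pos (χ : I → Γ →* ℤˣ) (G : Subgroup Γ) (J : I → ℝ) :
    0 < ∑ ω, rcWeight χ G J ω := by
  classical
  rw [sum_rcWeight]
  exact Finset.sum_pos (fun σ _ => Finset.prod_pos fun i _ => Real.exp_pos _)
    Finset.univ_nonempty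

omit [Fintype I] [DecidableEq I] in
open Classical in
/-- Griffiths' first inequality for a sum of spin products. -/
theorem sum_prod_realChar_nonneg (χ : I → Γ →* ℤˣ) (G : Subgroup Γ) (S : Finset I) :
    0 ≤ ∑ σ : G, ∏ i ∈ S, realChar (χ i) σ := by
  -- A product of characters is a character, and its sum over the group is the group order or 0.
  have := sum_hom_units ((∏ i ∈ S, realChar (χ i)).comp G.subtype)
  simp only [MonoidHom.comp_apply, MonoidHom.finsetProd_apply, Subgroup.subtype_apply] at this
  rw [this]
  exact Nat.cast_nonneg _

omit [Fintype Γ] in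
theorem exp_mul_realChar (K : ℝ) (f : Γ →* ℤˣ) (σ : Γ) :
    Real.exp (K * realChar f σ) = Real.sinh K * realChar f σ + Real.cosh K := by
  rcases realChar_eq_or f σ with ⟨-, h⟩ | ⟨-, h⟩
  · rw [h, mul_one, mul_one, Real.sinh_add_cosh]
  · rw [h, mul_neg, mul_one, mul_neg, mul_one, ← Real.cosh_sub_sinh]; ring

theorem abs_sinh_le {K K' : ℝ} (h : |K'| ≤ K) : |Real.sinh K'| ≤ Real.sinh K := by
  rw [abs_le] at h ⊢
  exact ⟨by rw [← Real.sinh_neg]; exact Real.sinh_le_sinh.2 h.1, Real.sinh_le_sinh.2 h.2⟩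

open Classical in
/-- A ferromagnetic partition function dominates those with couplings of smaller modulus. -/
theorem sum_prod_exp_le (χ : I → Γ →* ℤˣ) (G : Subgroup Γ) {K K' : I → ℝ}
    (h : ∀ i, |K' i| ≤ K i) :
    ∑ σ : G, ∏ i, Real.exp (K' i * realChar (χ i) σ) ≤
      ∑ σ : G, ∏ i, Real.exp (K i * realChar (χ i) σ) := by
  classical
  -- High-temperature expansion: exp (Kε) = cosh K + ε sinh K for ε = ±1. The spin sums are
  -- nonnegative and free of K, so only the hyperbolic coefficients have to be compared.
  have h1 : ∀ K : I → ℝ, ∑ σ : G, ∏ i, Real.exp (K i * realChar (χ i) σ) =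
      ∑ S : Finset I, ((∏ i ∈ S, Real.sinh (K i)) * ∏ i ∈ Sᶜ, Real.cosh (K i)) *
        ∑ σ : G, ∏ i ∈ S, realChar (χ i) σ := fun K => by
    simp_rw [exp_mul_realChar, Fintype.prod_add, Finset.prod_mul_distrib, Finset.mul_sum]
    rw [Finset.sum_comm]
    refine Finset.sum_congr rfl fun S _ => Finset.sum_congr rfl fun σ _ => by ring
  rw [h1, h1]
  refine Finset.sum_le_sum fun S _ =>
    mul_le_mul_of_nonneg_right ?_ (sum_prod_realChar_nonneg χ G S)
  have hK : ∀ i, 0 ≤ K i := fun i => (abs_nonneg _).trans (h i)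
  refine mul_le_mul ?_ (Finset.prod_le_prod (fun i _ => (Real.cosh_pos _).le) fun i _ => ?_)
    (Finset.prod_nonneg fun i _ => (Real.cosh_pos _).le)
    (Finset.prod_nonneg fun i _ => Real.sinh_nonneg_iff.2 (hK i))
  · refine (le_abs_self _).trans ?_
    rw [Finset.abs_prod]
    exact Finset.prod_le_prod (fun i _ => abs_nonneg _) fun i _ => abs_sinh_le (h i)
  · rw [Real.cosh_le_cosh, abs_of_nonneg (hK i)]
    exact h i

-- Substitute σ = θτ, which permutes G₁ for each τ because G₂ ≤ G₁. For fixed θ this leaves one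
-- system of spins τ, with couplings B + A or B - A edge by edge.
omit [DecidableEq I] in
open Classical in
theorem sum_mul_sum_exp (χ : I → Γ →* ℤˣ) {G₁ G₂ : Subgroup Γ} (hG : G₂ ≤ G₁) (A B : I → ℝ) :
    (∑ σ : G₁, ∏ i, Real.exp (A i * realChar (χ i) σ)) *
        ∑ σ : G₂, ∏ i, Real.exp (B i * realChar (χ i) σ) =
      ∑ θ : G₁, ∑ τ : G₂,
        ∏ i, Real.exp ((B i + A i * realChar (χ i) θ) * realChar (χ i) τ) := by
  rw [Finset.mul_sum, Finset.sum_comm]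
  refine Finset.sum_congr rfl fun τ _ => ?_
  rw [Finset.sum_mul,
    ← Equiv.sum_comp (Equiv.mulRight (⟨τ, hG τ.2⟩ : G₁)) fun σ : G₁ =>
      (∏ i, Real.exp (A i * realChar (χ i) σ)) * ∏ i, Real.exp (B i * realChar (χ i) τ)]
  refine Finset.sum_congr rfl fun θ _ => ?_
  rw [← Finset.prod_mul_distrib]
  refine Finset.prod_congr rfl fun i _ => ?_
  rw [← Real.exp_add]
  simp only [Equiv.coe_mulRight, Subgroup.coe_mul, map_mul]
  congr 1
  ring

/-- The Ginibre-type comparison of products of partition functions. -/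
theorem sum_rcWeight_mul_le (χ : I → Γ →* ℤˣ) {G₁ G₂ : Subgroup Γ} (hG : G₂ ≤ G₁)
    {A A' B B' : I → ℝ} (hadd : ∀ i, |A' i + B' i| ≤ A i + B i)
    (hsub : ∀ i, |B' i - A' i| ≤ B i - A i) :
    (∑ ω, rcWeight χ G₁ A' ω) * ∑ ω, rcWeight χ G₂ B' ω ≤
      (∑ ω, rcWeight χ G₁ A ω) * ∑ ω, rcWeight χ G₂ B ω := by
  classical
  simp_rw [sum_rcWeight, sum_mul_sum_exp χ hG]
  refine Finset.sum_le_sum fun θ _ => sum_prod_exp_le χ G₂ fun i => ?_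
  rcases realChar_eq_or (χ i) (θ : Γ) with ⟨-, h⟩ | ⟨-, h⟩ <;> rw [h]
  · simpa [add_comm] using hadd i
  · simpa [← sub_eq_add_neg] using hsub i

/-- The discrete four functions theorem with the lattice condition `rcWeight_mul_le`. The separate
majorant F' is there for an observable that also depends on the field: F and F' are its values at a
lower and at a higher field. -/
theorem sum_mul_rcWeight_mul_le (χ : I → Γ →* ℤˣ) {G₁ G₂ : Subgroup Γ} (hG : G₂ ≤ G₁)
    {J K : I → ℝ} (hJ : 0 ≤ J) (hJK : J ≤ K) {F F' H : (I → Bool) → ℝ} (hF : 0 ≤ F)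
    (hFF' : F ≤ F') (hF' : Monotone F') (hH : 0 ≤ H) (hHm : Monotone H) :
    (∑ ω, F ω * rcWeight χ G₁ J ω) * ∑ ω, H ω * rcWeight χ G₂ K ω ≤
      (∑ ω, rcWeight χ G₁ J ω) * ∑ ω, F' ω * H ω * rcWeight χ G₂ K ω := by
  have hK : 0 ≤ K := hJ.trans hJK
  have w1 := rcWeight_nonneg χ G₁ hJ
  have w2 := rcWeight_nonneg χ G₂ hK
  have hF0' : 0 ≤ F' := hF.trans hFF'
  refine four_functions_theorem_univ (fun ω => F ω * rcWeight χ G₁ J ω)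
    (fun ω => H ω * rcWeight χ G₂ K ω) _ (fun ω => F' ω * H ω * rcWeight χ G₂ K ω)
    (fun ω => mul_nonneg (hF ω) (w1 ω)) (fun ω => mul_nonneg (hH ω) (w2 ω)) w1
    (fun ω => mul_nonneg (mul_nonneg (hF0' ω) (hH ω)) (w2 ω)) fun ω ω' => ?_
  have h1 : F ω * H ω' ≤ F' (ω ⊔ ω') * H (ω ⊔ ω') :=
    mul_le_mul ((hFF' ω).trans (hF' le_sup_left)) (hHm le_sup_right) (hH _) (hF0' _)
  have h2 := mul_le_mul h1 (rcWeight_mul_le χ hG hJ hJK ω ω') (mul_nonneg (w1 _) (w2 _))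
    (mul_nonneg (hF0' _) (hH _))
  calc _ = _ := by ring
    _ ≤ _ := h2
    _ = _ := by ring

end Partition

end Phi4RC

namespace Phi4RC

/-! ### The four functions theorem for product measures -/

section FourFunctions

/-- The continuous four functions theorem holds for `μ`, with hypotheses on a conull set. -/
def FourFunctions {X : Type*} [MeasurableSpace X] [Lattice X] (μ : Measure X) : Prop :=
  ∀ f₁ f₂ f₃ f₄ : X → ℝ≥0∞, AEMeasurable f₁ μ → AEMeasurable f₂ μ → AEMeasurable f₃ μ →
    AEMeasurable f₄ μ → ∀ N : Set X, (∀ᵐ x ∂μ, x ∈ N) →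
    (∀ x ∈ N, ∀ y ∈ N, x ⊓ y ∈ N → x ⊔ y ∈ N → f₁ x * f₂ y ≤ f₃ (x ⊓ y) * f₄ (x ⊔ y)) →
    (∫⁻ x, f₁ x ∂μ) * ∫⁻ x, f₂ x ∂μ ≤ (∫⁻ x, f₃ x ∂μ) * ∫⁻ x, f₄ x ∂μ

/-- From (c - a)(c - b) ≥ 0 one gets c (a + b) ≤ c² + ab ≤ c (c + e). If c = 0, then a = b = 0. -/
theorem add_le_add_of_mul_le {a b c e : ℝ≥0∞} (ha : a ≤ c) (hb : b ≤ c) (h : a * b ≤ c * e) :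
    a + b ≤ c + e := by
  rcases eq_or_ne c ∞ with rfl | hc
  · simp
  rcases eq_or_ne e ∞ with rfl | he
  · simp
  lift c to ℝ≥0 using hc
  lift e to ℝ≥0 using he
  lift a to ℝ≥0 using ne_top_of_le_ne_top ENNReal.coe_ne_top ha
  lift b to ℝ≥0 using ne_top_of_le_ne_top ENNReal.coe_ne_top hb
  norm_cast at *
  rw [← NNReal.coe_le_coe] at *
  push_cast at *
  rcases c.coe_nonneg.eq_or_lt with h0 | h0
  · have := e.coe_nonneg
    linarith
  · refine le_of_mul_le_mul_left ?_ h0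
    nlinarith [mul_nonneg (sub_nonneg.2 ha) (sub_nonneg.2 hb)]

/-- Double both products of integrals and symmetrise over pairs (x, y); the integrands then compare
pointwise by `add_le_add_of_mul_le`, fed with the hypothesis at (x, y), (y, x) and the two diagonal
points. In a chain x ⊓ y and x ⊔ y are x and y themselves, so restricting to N costs nothing. -/
theorem fourFunctions_of_linearOrder {X : Type*} [MeasurableSpace X] [LinearOrder X]
    (μ : Measure X) [SFinite μ] : FourFunctions μ := by
  intro f₁ f₂ f₃ f₄ h₁ h₂ h₃ h₄ N hN h
  have key : ∀ x ∈ N, ∀ y ∈ N, x ≤ y →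
      f₁ x * f₂ y + f₂ x * f₁ y ≤ f₃ x * f₄ y + f₄ x * f₃ y := by
    intro x hx y hy hxy
    have hxN : x ⊓ y = x := inf_eq_left.2 hxy
    have hyN : x ⊔ y = y := sup_eq_right.2 hxy
    refine add_le_add_of_mul_le ?_ ?_ ?_
    · simpa [hxN, hyN] using h x hx y hy (by rwa [hxN]) (by rwa [hyN])
    · rw [inf_comm] at hxN
      rw [sup_comm] at hyN
      simpa [hxN, hyN, mul_comm] using h y hy x hx (by rwa [hxN]) (by rwa [hyN])
    · have hx' := h x hx x hx (by simpa) (by simpa)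
      have hy' := h y hy y hy (by simpa) (by simpa)
      simp only [inf_idem, sup_idem] at hx' hy'
      calc _ = (f₁ x * f₂ x) * (f₁ y * f₂ y) := by ring
        _ ≤ (f₃ x * f₄ x) * (f₃ y * f₄ y) := mul_le_mul' hx' hy'
        _ = _ := by ring
  have hsum : ∀ {f g : X → ℝ≥0∞}, AEMeasurable f μ → AEMeasurable g μ →
      2 * ((∫⁻ x, f x ∂μ) * ∫⁻ x, g x ∂μ) =
        ∫⁻ z, (f z.1 * g z.2 + g z.1 * f z.2) ∂μ.prod μ := fun {f g} hf hg => by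
    have h0 : AEMeasurable (fun z : X × X => f z.1 * g z.2) (μ.prod μ) :=
      hf.comp_fst.mul hg.comp_snd
    rw [lintegral_add_left' h0, lintegral_prod_mul hf hg, lintegral_prod_mul hg hf, two_mul,
      mul_comm (∫⁻ x, g x ∂μ)]
  rw [← ENNReal.mul_le_mul_iff_right (a := 2) (by simp) (by simp), hsum h₁ h₂, hsum h₃ h₄]
  refine lintegral_mono_ae ?_
  filter_upwards [Measure.quasiMeasurePreserving_fst.ae hN,
    Measure.quasiMeasurePreserving_snd.ae hN] with z hz₁ hz₂
  rcases le_total z.1 z.2 with hz | hz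
  · exact key _ hz₁ _ hz₂ hz
  · have := key _ hz₂ _ hz₁ hz
    simpa only [add_comm, mul_comm] using this

theorem ae_aemeasurable_slice {X Y : Type*} [MeasurableSpace X] [MeasurableSpace Y]
    {μ : Measure X} {ν : Measure Y} [SFinite ν] {f : X × Y → ℝ≥0∞}
    (hf : AEMeasurable f (μ.prod ν)) : ∀ᵐ x ∂μ, AEMeasurable (fun y => f (x, y)) ν := by
  filter_upwards [hf.aestronglyMeasurable.prodMk_left] with x hx using hx.aemeasurable

theorem FourFunctions.prod {X Y : Type*} [MeasurableSpace X] [MeasurableSpace Y] [Lattice X]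
    [Lattice Y] {μ : Measure X} {ν : Measure Y} [SFinite μ] [SFinite ν] (hμ : FourFunctions μ)
    (hν : FourFunctions ν) : FourFunctions (μ.prod ν) := by
  intro f₁ f₂ f₃ f₄ h₁ h₂ h₃ h₄ N hN h
  rw [lintegral_prod _ h₁, lintegral_prod _ h₂, lintegral_prod _ h₃, lintegral_prod _ h₄]
  -- The partial integrals are the four functions on X. Slices of a.e. measurable functions are a.e.
  -- measurable only for almost every x, which is why the hypothesis has to be allowed on a conull
  -- set only.
  refine hμ _ _ _ _ h₁.lintegral_prod_right' h₂.lintegral_prod_right' h₃.lintegral_prod_right'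
    h₄.lintegral_prod_right' {x | (∀ᵐ y ∂ν, (x, y) ∈ N) ∧
      AEMeasurable (fun y => f₁ (x, y)) ν ∧ AEMeasurable (fun y => f₂ (x, y)) ν ∧
      AEMeasurable (fun y => f₃ (x, y)) ν ∧ AEMeasurable (fun y => f₄ (x, y)) ν} ?_ ?_
  · filter_upwards [Measure.ae_ae_of_ae_prod hN, ae_aemeasurable_slice h₁,
      ae_aemeasurable_slice h₂, ae_aemeasurable_slice h₃, ae_aemeasurable_slice h₄] with x a b c e f using ⟨a, b, c, e, f⟩
  · intro x hx y hy hi hs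
    refine hν _ _ _ _ hx.2.1 hy.2.2.1 hi.2.2.2.1 hs.2.2.2.2
      -- Conull because all four base points x, y, x ⊓ y, x ⊔ y have conull slices.
      {z | (x, z) ∈ N ∧ (y, z) ∈ N ∧ (x ⊓ y, z) ∈ N ∧ (x ⊔ y, z) ∈ N} ?_ ?_
    · filter_upwards [hx.1, hy.1, hi.1, hs.1] with z a b c e using ⟨a, b, c, e⟩
    · exact fun z hz w hw hzi hzs => h (x, z) hz.1 (y, w) hw.2.1 hzi.2.2.1 hzs.2.2.2

theorem FourFunctions.of_measurePreserving {X Y : Type*} [MeasurableSpace X]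
    [MeasurableSpace Y] [Lattice X] [Lattice Y] {μ : Measure X} {ν : Measure Y}
    (hμ : FourFunctions μ) {g : X → Y} (hg : MeasurePreserving g μ ν)
    (hinf : ∀ x y, g (x ⊓ y) = g x ⊓ g y) (hsup : ∀ x y, g (x ⊔ y) = g x ⊔ g y) :
    FourFunctions ν := by
  intro f₁ f₂ f₃ f₄ h₁ h₂ h₃ h₄ N hN h
  rw [← hg.map_eq] at h₁ h₂ h₃ h₄ ⊢
  rw [lintegral_map' h₁ hg.aemeasurable, lintegral_map' h₂ hg.aemeasurable,
    lintegral_map' h₃ hg.aemeasurable, lintegral_map' h₄ hg.aemeasurable]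
  refine hμ _ _ _ _ (h₁.comp_measurable hg.measurable) (h₂.comp_measurable hg.measurable)
    (h₃.comp_measurable hg.measurable) (h₄.comp_measurable hg.measurable) (g ⁻¹' N)
    (hg.quasiMeasurePreserving.ae hN) fun x hx y hy hi hs => ?_
  have := h (g x) hx (g y) hy (by rw [← hinf]; exact hi) (by rw [← hsup]; exact hs)
  simpa only [hinf, hsup] using this

theorem fourFunctions_pi_fin {X : Type*} [MeasurableSpace X] [LinearOrder X] (μ : Measure X)
    [IsProbabilityMeasure μ] (n : ℕ) : FourFunctions (Measure.pi fun _ : Fin n => μ) := by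
  induction n with
  | zero =>
    intro f₁ f₂ f₃ f₄ _ _ _ _ N hN h
    obtain ⟨x, hx⟩ := hN.exists
    simp only [lintegral_unique, measure_univ, mul_one]
    have h0 := h x hx x hx (by simpa) (by simpa)
    simpa [Subsingleton.elim x default] using h0
  | succ n ih =>
    exact ((fourFunctions_of_linearOrder μ).prod ih).of_measurePreserving
      ((measurePreserving_piFinSuccAbove (fun _ : Fin (n + 1) => μ) 0).symm _)
      (fun x y => by
        ext i; refine Fin.cases ?_ (fun j => ?_) i <;>
          simp [MeasurableEquiv.piFinSuccAbove, Fin.insertNthEquiv])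
      (fun x y => by
        ext i; refine Fin.cases ?_ (fun j => ?_) i <;>
          simp [MeasurableEquiv.piFinSuccAbove, Fin.insertNthEquiv])

theorem fourFunctions_pi {ι X : Type*} [Fintype ι] [MeasurableSpace X] [LinearOrder X]
    (μ : Measure X) [IsProbabilityMeasure μ] : FourFunctions (Measure.pi fun _ : ι => μ) := by
  refine (fourFunctions_pi_fin μ (Fintype.card ι)).of_measurePreserving
    (measurePreserving_piCongrLeft (fun _ : ι => μ) (Fintype.equivFin ι).symm) ?_ ?_ <;>
  · intro x y
    ext i
    simp [MeasurableEquiv.coe_piCongrLeft, Equiv.piCongrLeft_apply]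

end FourFunctions

end Phi4RC

namespace Phi4RC

/-! ### The weight as a random cluster weight over spins -/

section Weight

variable {d : ℕ} {Λ : Finset (Fin d → ℤ)}

/-- The product of the two spins at the endpoints of an edge. -/
def edgeChar : edges Λ ⊕ Λ → (Option (closedVolume Λ) → ℤˣ) →* ℤˣ
  | Sum.inl e => MonoidHom.mk' (fun σ => ((e : Sym2 (closedVolume Λ)).map fun x => σ (some x)).mul)
      fun σ τ => by
        induction (e : Sym2 (closedVolume Λ)) using Sym2.ind with
        | _ x y => simp [mul_mul_mul_comm]
  | Sum.inr x => MonoidHom.mk' (fun σ => σ (some ⟨x, mem_closedVolume_of_mem x.2⟩) * σ none)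
      fun σ τ => by simp [mul_mul_mul_comm]

theorem mem_closedVolume_of_mem_extBoundary {x : Fin d → ℤ} (hx : x ∈ extBoundary Λ) :
    x ∈ closedVolume Λ := Finset.mem_union_right _ hx

/-- The spin configurations which are constant on the classes of `ξ`. -/
def constantOn (ξ : Setoid (extBoundary Λ)) : Subgroup (Option (closedVolume Λ) → ℤˣ) where
  carrier := {σ | ∀ x y, ξ x y → σ (some ⟨x, mem_closedVolume_of_mem_extBoundary x.2⟩) =
    σ (some ⟨y, mem_closedVolume_of_mem_extBoundary y.2⟩)}
  mul_mem' hσ hτ x y h := by simp only [Pi.mul_apply, hσ x y h, hτ x y h]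
  one_mem' _ _ _ := rfl
  inv_mem' hσ x y h := by simp only [Pi.inv_apply, hσ x y h]

theorem constantOn_anti {ξ₁ ξ₂ : Setoid (extBoundary Λ)} (h : ξ₁ ≤ ξ₂) :
    constantOn ξ₂ ≤ constantOn ξ₁ := fun _ hσ x y hxy => hσ x y (h hxy)

theorem intUnits_mul_eq_one {a b : ℤˣ} : a * b = 1 ↔ a = b := by
  rw [mul_eq_one_iff_eq_inv, Int.units_inv_eq_self]

theorem mem_satisfying_iff (ξ : Setoid (extBoundary Λ)) (ω : Config Λ)
    (σ : Option (closedVolume Λ) → ℤˣ) :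
    σ ∈ satisfying edgeChar (constantOn ξ) ω ↔
      Relation.EqvGen.setoid (Joined ξ ω) ≤ Setoid.ker σ := by
  rw [mem_satisfying]
  constructor
  · rintro ⟨hσ, hω⟩
    refine Setoid.eqvGen_le ?_
    rintro (_ | x) (_ | y) hxy
    · exact hxy.elim
    · exact hxy.elim
    · obtain ⟨hx, ho⟩ := hxy
      exact intUnits_mul_eq_one.1 (hω (Sum.inr ⟨x, hx⟩) ho)
    · rcases hxy with ⟨e, he, ho⟩ | ⟨hx, hy, h⟩
      · have := hω (Sum.inl e) ho
        simp only [edgeChar, he, MonoidHom.mk'_apply, Sym2.map_mk, Sym2.mul_mk] at this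
        exact intUnits_mul_eq_one.1 this
      · exact hσ _ _ h
  · intro h
    have hr : ∀ x y, Joined ξ ω x y → σ x = σ y := fun x y hxy => h (Relation.EqvGen.rel _ _ hxy)
    refine ⟨fun x y hxy => hr _ _ (Or.inr ⟨x.2, y.2, hxy⟩), ?_⟩
    rintro (⟨e, he⟩ | x) ho
    · induction e using Sym2.ind with
      | _ x y =>
        simp only [edgeChar, MonoidHom.mk'_apply, Sym2.map_mk, Sym2.mul_mk]
        exact intUnits_mul_eq_one.2 (hr _ _ (Or.inl ⟨_, rfl, ho⟩))
    · exact intUnits_mul_eq_one.2 (hr _ _ ⟨x.2, ho⟩)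

/-- Compatible spins are exactly the sign functions on the set of clusters. The sign at the ghost is
free as well, in agreement with its cluster being counted. -/
theorem card_satisfying (ξ : Setoid (extBoundary Λ)) (ω : Config Λ) :
    Nat.card (satisfying edgeChar (constantOn ξ) ω) = 2 ^ numClusters ξ ω := by
  have h2 : Nat.card ℤˣ = 2 := by simp
  rw [numClusters, ← h2, ← Nat.card_fun]
  exact Nat.card_congr ((Equiv.subtypeEquivRight (mem_satisfying_iff ξ ω)).trans
    (Setoid.liftEquiv _))

/-- The coupling constants of the edges. -/
def coupling (β : ℝ) (h : Λ → ℝ≥0) (s : AbsField Λ) : edges Λ ⊕ Λ → ℝ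
  | Sum.inl e => β * (((e : Sym2 (closedVolume Λ)).map s).mul : ℝ≥0)
  | Sum.inr x => β * h x * s ⟨x, mem_closedVolume_of_mem x.2⟩

/-- Here √(1 - p) = exp (-J), and p / (1 - p) = exp (2J) - 1. -/
theorem edgeFactor_eq (J : ℝ) (o : Bool) :
    edgeFactor (1 - Real.exp (-2 * J)) o = bondFactor J o := by
  have h1 : Real.exp (-2 * J) = Real.exp (-J) * Real.exp (-J) := by
    rw [← Real.exp_add]; congr 1; ring
  have h2 : Real.exp J * Real.exp (-J) = 1 := by rw [← Real.exp_add]; simp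
  have h3 : Real.exp (-J) ≠ 0 := (Real.exp_pos _).ne'
  have h4 : Real.exp J = 1 / Real.exp (-J) := by field_simp; exact h2
  rw [edgeFactor, sub_sub_cancel, h1, Real.sqrt_mul_self (Real.exp_pos _).le]
  cases o
  · simp [bondFactor]
  · simp only [bondFactor, Bool.toNat_true, pow_one, if_true, h4]
    field_simp

theorem weight_eq (β : ℝ) (h : Λ → ℝ≥0) (ξ : Setoid (extBoundary Λ)) (ω : Config Λ)
    (s : AbsField Λ) :
    weight β h ξ (ω, s) = rcWeight edgeChar (constantOn ξ) (coupling β h s) ω := by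
  rw [weight, rcWeight, card_satisfying, Fintype.prod_sum_type]
  push_cast
  congr 2
  · refine Finset.prod_congr rfl fun e _ => ?_
    rw [← edgeFactor_eq, edgeProb, coupling, mul_assoc]
  · refine Finset.prod_congr rfl fun x _ => ?_
    rw [← edgeFactor_eq, ghostProb, coupling, mul_assoc, mul_assoc, mul_assoc]

theorem coupling_nonneg {β : ℝ} (hβ : 0 ≤ β) (h : Λ → ℝ≥0) (s : AbsField Λ) :
    0 ≤ coupling β h s := by
  rintro (e | x) <;> simp only [coupling, Pi.zero_apply] <;> positivity

theorem coupling_mono {β₁ β₂ : ℝ} (hβ₁ : 0 ≤ β₁) (hβ : β₁ ≤ β₂) {h₁ h₂ : Λ → ℝ≥0}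
    (hh : h₁ ≤ h₂) {s t : AbsField Λ} (hst : s ≤ t) : coupling β₁ h₁ s ≤ coupling β₂ h₂ t := by
  have hβ₂ := hβ₁.trans hβ
  rintro (⟨e, he⟩ | x)
  · induction e using Sym2.ind with
    | _ x y =>
      simp only [coupling, Sym2.map_mk, Sym2.mul_mk]
      gcongr
      exacts [hst x, hst y]
  · simp only [coupling]
    gcongr
    exacts [hh x, hst _]

theorem mul_add_mul_le_inf_sup (a b c e : ℝ≥0) :
    a * b + c * e ≤ (a ⊓ c) * (b ⊓ e) + (a ⊔ c) * (b ⊔ e) := by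
  rw [← NNReal.coe_le_coe]
  rcases le_total a c with h | h <;> rcases le_total b e with h' | h' <;>
    simp only [inf_eq_left.2, inf_eq_right.2, sup_eq_left.2, sup_eq_right.2, h, h',
      NNReal.coe_add, NNReal.coe_mul, le_refl] <;>
    rw [← NNReal.coe_le_coe] at h h' <;> nlinarith [mul_nonneg (sub_nonneg.2 h) (sub_nonneg.2 h')]

/-- Write J₂ = J₁ + (J₂ - J₁): the first term is supermodular in the field (`hsup`), the second
increasing in it (`hmono`). -/
theorem coupling_add_le {β₁ β₂ : ℝ} (hβ₁ : 0 ≤ β₁) (hβ : β₁ ≤ β₂) {h₁ h₂ : Λ → ℝ≥0}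
    (hh : h₁ ≤ h₂) (s t : AbsField Λ) (i : edges Λ ⊕ Λ) :
    coupling β₁ h₁ s i + coupling β₂ h₂ t i ≤
      coupling β₁ h₁ (s ⊓ t) i + coupling β₂ h₂ (s ⊔ t) i := by
  have hmono : coupling β₂ h₂ t i - coupling β₁ h₁ t i ≤
      coupling β₂ h₂ (s ⊔ t) i - coupling β₁ h₁ (s ⊔ t) i := by
    have hst : t ≤ s ⊔ t := le_sup_right
    rcases i with ⟨e, he⟩ | x
    · simp only [coupling, ← sub_mul]
      refine mul_le_mul_of_nonneg_left ?_ (sub_nonneg.2 hβ)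
      induction e using Sym2.ind with
      | _ x y =>
        simp only [Sym2.map_mk, Sym2.mul_mk]
        exact NNReal.coe_le_coe.2 (mul_le_mul' (hst x) (hst y))
    · simp only [coupling, ← sub_mul]
      exact mul_le_mul_of_nonneg_left (NNReal.coe_le_coe.2 (hst _))
        (sub_nonneg.2 (mul_le_mul hβ (NNReal.coe_le_coe.2 (hh x)) (NNReal.coe_nonneg _)
          (hβ₁.trans hβ)))
  have hsup : coupling β₁ h₁ s i + coupling β₁ h₁ t i ≤
      coupling β₁ h₁ (s ⊓ t) i + coupling β₁ h₁ (s ⊔ t) i := by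
    rcases i with ⟨e, he⟩ | x
    · simp only [coupling, ← mul_add]
      refine mul_le_mul_of_nonneg_left ?_ hβ₁
      induction e using Sym2.ind with
      | _ x y =>
        simp only [Sym2.map_mk, Sym2.mul_mk]
        exact_mod_cast mul_add_mul_le_inf_sup (s x) (s y) (t x) (t y)
    · simp only [coupling, ← mul_add]
      refine mul_le_mul_of_nonneg_left ?_ (by positivity)
      exact_mod_cast (min_add_max (s ⟨x, mem_closedVolume_of_mem x.2⟩)
        (t ⟨x, mem_closedVolume_of_mem x.2⟩)).ge
  linarith

theorem weight_nonneg {β : ℝ} (hβ : 0 ≤ β) (h : Λ → ℝ≥0) (ξ : Setoid (extBoundary Λ))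
    (q : Config Λ × AbsField Λ) : 0 ≤ weight β h ξ q := by
  rw [show q = (q.1, q.2) from rfl, weight_eq]
  exact rcWeight_nonneg _ _ (coupling_nonneg hβ h _) _

theorem sum_weight_pos (β : ℝ) (h : Λ → ℝ≥0) (ξ : Setoid (extBoundary Λ)) (s : AbsField Λ) :
    0 < ∑ ω, weight β h ξ (ω, s) := by
  simp_rw [weight_eq]
  exact sum_rcWeight_pos _ _ _

/-- The lattice condition for the density of the absolute value field. -/
theorem sum_weight_mul_le {β₁ β₂ : ℝ} (hβ₁ : 0 ≤ β₁) (hβ : β₁ ≤ β₂) {h₁ h₂ : Λ → ℝ≥0}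
    (hh : h₁ ≤ h₂) {ξ₁ ξ₂ : Setoid (extBoundary Λ)} (hξ : ξ₁ ≤ ξ₂) (s t : AbsField Λ) :
    (∑ ω, weight β₁ h₁ ξ₁ (ω, s)) * ∑ ω, weight β₂ h₂ ξ₂ (ω, t) ≤
      (∑ ω, weight β₁ h₁ ξ₁ (ω, s ⊓ t)) * ∑ ω, weight β₂ h₂ ξ₂ (ω, s ⊔ t) := by
  simp_rw [weight_eq]
  refine sum_rcWeight_mul_le edgeChar (constantOn_anti hξ) (fun i => ?_) fun i => ?_
  · rw [abs_of_nonneg (add_nonneg (coupling_nonneg hβ₁ _ _ i)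
      (coupling_nonneg (hβ₁.trans hβ) _ _ i))]
    exact coupling_add_le hβ₁ hβ hh s t i
  -- Both J₁(s) and J₂(t) lie between J₁(s ⊓ t) and J₂(s ⊔ t), which bounds their distance.
  · have a1 := coupling_mono hβ₁ le_rfl (le_refl h₁) (inf_le_left : s ⊓ t ≤ s) i
    have a2 := coupling_mono hβ₁ hβ hh (inf_le_right : s ⊓ t ≤ t) i
    have a3 := coupling_mono hβ₁ hβ hh (le_sup_left : s ≤ s ⊔ t) i
    have a4 := coupling_mono (hβ₁.trans hβ) le_rfl (le_refl h₂) (le_sup_right : t ≤ s ⊔ t) i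
    rw [abs_le]
    constructor <;> linarith

/-- Given the field, the percolation configurations are positively associated and increasing in
the parameters. -/
theorem sum_mul_weight_mul_le {β₁ β₂ : ℝ} (hβ₁ : 0 ≤ β₁) (hβ : β₁ ≤ β₂) {h₁ h₂ : Λ → ℝ≥0}
    (hh : h₁ ≤ h₂) {ξ₁ ξ₂ : Setoid (extBoundary Λ)} (hξ : ξ₁ ≤ ξ₂) {s t : AbsField Λ}
    (hst : s ≤ t) {F G : Config Λ × AbsField Λ → ℝ} (hF : 0 ≤ F) (hFm : Monotone F)
    (hG : 0 ≤ G) (hGm : Monotone G) :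
    (∑ ω, F (ω, s) * weight β₁ h₁ ξ₁ (ω, s)) * ∑ ω, G (ω, t) * weight β₂ h₂ ξ₂ (ω, t) ≤
      (∑ ω, weight β₁ h₁ ξ₁ (ω, s)) *
        ∑ ω, F (ω, t) * G (ω, t) * weight β₂ h₂ ξ₂ (ω, t) := by
  simp_rw [weight_eq]
  exact sum_mul_rcWeight_mul_le edgeChar (constantOn_anti hξ) (coupling_nonneg hβ₁ _ _)
    (coupling_mono hβ₁ hβ hh hst) (F := fun ω => F (ω, s)) (F' := fun ω => F (ω, t))
    (H := fun ω => G (ω, t)) (fun ω => hF _) (fun ω => hFm ⟨le_rfl, hst⟩)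
    (fun _ _ hω => hFm ⟨hω, le_rfl⟩) (fun ω => hG _) (fun _ _ hω => hGm ⟨hω, le_rfl⟩)

/-- The two levels combined: the hypothesis of the four functions theorem for the field. -/
theorem sum_mul_weight_mul_le_sup {β₁ β₂ : ℝ} (hβ₁ : 0 ≤ β₁) (hβ : β₁ ≤ β₂)
    {h₁ h₂ : Λ → ℝ≥0} (hh : h₁ ≤ h₂) {ξ₁ ξ₂ : Setoid (extBoundary Λ)} (hξ : ξ₁ ≤ ξ₂)
    (s t : AbsField Λ) {F G : Config Λ × AbsField Λ → ℝ} (hF : 0 ≤ F) (hFm : Monotone F)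
    (hG : 0 ≤ G) (hGm : Monotone G) :
    (∑ ω, F (ω, s) * weight β₁ h₁ ξ₁ (ω, s)) * ∑ ω, G (ω, t) * weight β₂ h₂ ξ₂ (ω, t) ≤
      (∑ ω, weight β₁ h₁ ξ₁ (ω, s ⊓ t)) *
        ∑ ω, F (ω, s ⊔ t) * G (ω, s ⊔ t) * weight β₂ h₂ ξ₂ (ω, s ⊔ t) := by
  have hβ₂ := hβ₁.trans hβ
  -- With ⟨·⟩ the average over ω at a given field, `h1` says ⟨F⟩₁,ₛ ⟨G⟩₂,ₛ⊔ₜ ≤ ⟨F G⟩₂,ₛ⊔ₜ and `h2`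
  -- says ⟨G⟩₂,ₜ ≤ ⟨G⟩₂,ₛ⊔ₜ. The partition functions are then exchanged by `hZ`.
  have hZ := sum_weight_mul_le hβ₁ hβ hh hξ s t
  have h1 := sum_mul_weight_mul_le hβ₁ hβ hh hξ (le_sup_left : s ≤ s ⊔ t) hF hFm hG hGm
  have h2 := sum_mul_weight_mul_le hβ₂ le_rfl (le_refl h₂) (le_refl ξ₂)
    (le_sup_right : t ≤ s ⊔ t) hG hGm (zero_le_one' (Config Λ × AbsField Λ → ℝ)) monotone_const
  simp only [Pi.one_apply, one_mul, mul_one] at h2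
  have p1 := sum_weight_pos β₁ h₁ ξ₁ s
  have p2 := sum_weight_pos β₂ h₂ ξ₂ t
  have p4 := sum_weight_pos β₂ h₂ ξ₂ (s ⊔ t)
  have nF : 0 ≤ ∑ ω, F (ω, s) * weight β₁ h₁ ξ₁ (ω, s) :=
    Finset.sum_nonneg fun ω _ => mul_nonneg (hF _) (weight_nonneg hβ₁ _ _ _)
  have nFG : 0 ≤ ∑ ω, F (ω, s ⊔ t) * G (ω, s ⊔ t) * weight β₂ h₂ ξ₂ (ω, s ⊔ t) :=
    Finset.sum_nonneg fun ω _ => mul_nonneg (mul_nonneg (hF _) (hG _)) (weight_nonneg hβ₂ _ _ _)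
  set Z1 := ∑ ω, weight β₁ h₁ ξ₁ (ω, s)
  set Z2 := ∑ ω, weight β₂ h₂ ξ₂ (ω, t)
  set Z3 := ∑ ω, weight β₁ h₁ ξ₁ (ω, s ⊓ t)
  set Z4 := ∑ ω, weight β₂ h₂ ξ₂ (ω, s ⊔ t)
  set S1 := ∑ ω, F (ω, s) * weight β₁ h₁ ξ₁ (ω, s)
  set S2 := ∑ ω, G (ω, t) * weight β₂ h₂ ξ₂ (ω, t)
  set S3 := ∑ ω, G (ω, s ⊔ t) * weight β₂ h₂ ξ₂ (ω, s ⊔ t)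
  set S4 := ∑ ω, F (ω, s ⊔ t) * G (ω, s ⊔ t) * weight β₂ h₂ ξ₂ (ω, s ⊔ t)
  refine le_of_mul_le_mul_right ?_ p4
  calc S1 * S2 * Z4 = S1 * (S2 * Z4) := by ring
    _ ≤ S1 * (Z2 * S3) := mul_le_mul_of_nonneg_left h2 nF
    _ = Z2 * (S1 * S3) := by ring
    _ ≤ Z2 * (Z1 * S4) := mul_le_mul_of_nonneg_left h1 p2.le
    _ = (Z1 * Z2) * S4 := by ring
    _ ≤ (Z3 * Z4) * S4 := mul_le_mul_of_nonneg_right hZ nFG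
    _ = Z3 * S4 * Z4 := by ring

end Weight

end Phi4RC

namespace Phi4RC

/-! ### Reduction of the inequalities to nonnegative increasing functions -/

section Correlation

theorem isProbabilityMeasure_normalize {X : Type*} [MeasurableSpace X] {μ : Measure X}
    (h0 : μ Set.univ ≠ 0) (h1 : μ Set.univ ≠ ∞) : IsProbabilityMeasure (normalize μ) :=
  ⟨by rw [normalize, Measure.smul_apply, smul_eq_mul, ENNReal.inv_mul_cancel h0 h1]⟩

variable {X : Type*} [MeasurableSpace X] [Preorder X] {μ ν : Measure X}

/-- A common form of positive association and stochastic domination. -/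
def Correlated (μ ν : Measure X) : Prop :=
  ∀ F G : X → ℝ, 0 ≤ F → Monotone F → 0 ≤ G → Monotone G → AEMeasurable F μ →
    AEMeasurable F ν → AEMeasurable G ν →
    (∫⁻ q, ENNReal.ofReal (F q) ∂μ) * ∫⁻ q, ENNReal.ofReal (G q) ∂ν ≤
      ∫⁻ q, ENNReal.ofReal (F q * G q) ∂ν

-- Truncation at -n keeps F increasing and makes F + n nonnegative; being dominated by |F|, it
-- disappears in the limit.
omit [MeasurableSpace X] in
theorem monotone_truncate {F : X → ℝ} (hF : Monotone F) (n : ℕ) :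
    Monotone fun q => max (F q) (-n : ℝ) :=
  fun _ _ h => max_le_max_right _ (hF h)

theorem abs_truncate_le (x : ℝ) (n : ℕ) : |max x (-n)| ≤ |x| := by
  have hn : (0 : ℝ) ≤ n := n.cast_nonneg
  rcases le_total x (-n) with h | h
  · rw [max_eq_right h, abs_neg, abs_of_nonneg hn, abs_of_nonpos (by linarith)]
    linarith
  · rw [max_eq_left h]

theorem tendsto_truncate (x : ℝ) :
    Filter.Tendsto (fun n : ℕ => max x (-n)) Filter.atTop (nhds x) := by
  obtain ⟨N, hN⟩ := exists_nat_ge (-x)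
  refine tendsto_const_nhds.congr' ?_
  filter_upwards [Filter.eventually_ge_atTop N] with n hn
  have : (N : ℝ) ≤ n := Nat.cast_le.2 hn
  rw [max_eq_left (by linarith)]

omit [Preorder X] in
theorem aestronglyMeasurable_truncate {F : X → ℝ} (hF : AEStronglyMeasurable F μ) (n : ℕ) :
    AEStronglyMeasurable (fun q => max (F q) (-n : ℝ)) μ :=
  (hF.aemeasurable.max aemeasurable_const).aestronglyMeasurable

omit [Preorder X] in
theorem integrable_truncate {F : X → ℝ} (hF : Integrable F μ) (n : ℕ) :
    Integrable (fun q => max (F q) (-n : ℝ)) μ :=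
  hF.mono (aestronglyMeasurable_truncate hF.1 n) (.of_forall fun _ => abs_truncate_le _ n)

omit [Preorder X] in
theorem tendsto_integral_truncate {F : X → ℝ} (hF : Integrable F μ) :
    Filter.Tendsto (fun n : ℕ => ∫ q, max (F q) (-n : ℝ) ∂μ) Filter.atTop
      (nhds (∫ q, F q ∂μ)) :=
  tendsto_integral_of_dominated_convergence (fun q => |F q|)
    (fun n => aestronglyMeasurable_truncate hF.1 n) hF.abs
    (fun n => .of_forall fun _ => abs_truncate_le _ n) (.of_forall fun _ => tendsto_truncate _)

/-- The case G = 1; the shift by n adds the same constant under both probability measures. -/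
theorem Correlated.stochDom [IsProbabilityMeasure μ] [IsProbabilityMeasure ν]
    (h : Correlated μ ν) : StochDom μ ν := by
  intro F hF hμ hν
  refine le_of_tendsto_of_tendsto' (tendsto_integral_truncate hμ) (tendsto_integral_truncate hν)
    fun n => ?_
  have iμ := integrable_truncate hμ n
  have iν := integrable_truncate hν n
  set Fn : X → ℝ := fun q => max (F q) (-n : ℝ)
  have h0 : 0 ≤ fun q => Fn q + n := fun q => by
    have : (-n : ℝ) ≤ Fn q := le_max_right _ _
    simp only [Pi.zero_apply]; linarith
  have jμ : Integrable (fun q => Fn q + n) μ := iμ.add (integrable_const _)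
  have jν : Integrable (fun q => Fn q + n) ν := iν.add (integrable_const _)
  have key := h (fun q => Fn q + n) 1 h0 ((monotone_truncate hF n).add_const _) zero_le_one
    monotone_const jμ.aemeasurable jν.aemeasurable aemeasurable_const
  simp only [Pi.one_apply, mul_one, ENNReal.ofReal_one, lintegral_const, measure_univ] at key
  rw [← ofReal_integral_eq_lintegral_ofReal jμ (.of_forall h0),
    ← ofReal_integral_eq_lintegral_ofReal jν (.of_forall h0),
    ENNReal.ofReal_le_ofReal_iff (integral_nonneg h0), integral_add iμ (integrable_const _),
    integral_add iν (integrable_const _)] at key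
  simpa using key

/-- Shifting F and G by c makes them nonnegative and leaves their covariance unchanged. -/
theorem Correlated.integral_mul_le_of_bddBelow [IsProbabilityMeasure μ] (h : Correlated μ μ)
    {F G : X → ℝ} (hF : Monotone F) (hG : Monotone G) (iF : MemLp F 2 μ) (iG : MemLp G 2 μ)
    {c : ℝ} (hcF : ∀ q, -c ≤ F q) (hcG : ∀ q, -c ≤ G q) :
    (∫ q, F q ∂μ) * ∫ q, G q ∂μ ≤ ∫ q, F q * G q ∂μ := by
  have hF0 : 0 ≤ fun q => F q + c := fun q => by
    have := hcF q
    simp only [Pi.zero_apply]; linarith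
  have hG0 : 0 ≤ fun q => G q + c := fun q => by
    have := hcG q
    simp only [Pi.zero_apply]; linarith
  have i1 : Integrable F μ := iF.integrable (by norm_num)
  have i2 : Integrable G μ := iG.integrable (by norm_num)
  have i3 : Integrable (fun q => F q * G q) μ := iF.integrable_mul iG
  have j1 : Integrable (fun q => F q + c) μ := i1.add (integrable_const _)
  have j2 : Integrable (fun q => G q + c) μ := i2.add (integrable_const _)
  have e : (fun q => (F q + c) * (G q + c)) =
      fun q => (F q * G q + (c * F q + c * G q)) + c * c := by
    ext q; ring
  have i4 : Integrable (fun q => c * F q + c * G q) μ := (i1.const_mul c).add (i2.const_mul c)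
  have i5 : Integrable (fun q => F q * G q + (c * F q + c * G q)) μ := i3.add i4
  have j3 : Integrable (fun q => (F q + c) * (G q + c)) μ := by
    rw [e]; exact i5.add (integrable_const _)
  have key := h _ _ hF0 (hF.add_const c) hG0 (hG.add_const c) j1.aemeasurable j1.aemeasurable
    j2.aemeasurable
  rw [← ofReal_integral_eq_lintegral_ofReal j1 (.of_forall hF0),
    ← ofReal_integral_eq_lintegral_ofReal j2 (.of_forall hG0),
    ← ofReal_integral_eq_lintegral_ofReal j3 (.of_forall fun q => mul_nonneg (hF0 q) (hG0 q)),
    ← ENNReal.ofReal_mul (integral_nonneg hF0), ENNReal.ofReal_le_ofReal_iff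
      (integral_nonneg fun q => mul_nonneg (hF0 q) (hG0 q)), e,
    integral_add i5 (integrable_const _), integral_add i3 i4,
    integral_add (i1.const_mul c) (i2.const_mul c), integral_add i1 (integrable_const _),
    integral_add i2 (integrable_const _), integral_const_mul, integral_const_mul] at key
  simp only [integral_const, probReal_univ, one_smul] at key
  nlinarith

theorem Correlated.hasFKG [IsProbabilityMeasure μ] (h : Correlated μ μ) : HasFKG μ := by
  intro F G hF hG iF iG
  have i1 : Integrable F μ := iF.integrable (by norm_num)
  have i2 : Integrable G μ := iG.integrable (by norm_num)
  have i3 : Integrable (fun q => F q * G q) μ := iF.integrable_mul iG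
  have hlim : Filter.Tendsto (fun n : ℕ => ∫ q, max (F q) (-n : ℝ) * max (G q) (-n : ℝ) ∂μ)
      Filter.atTop (nhds (∫ q, F q * G q ∂μ)) :=
    tendsto_integral_of_dominated_convergence (fun q => |F q * G q|)
      (fun n => (aestronglyMeasurable_truncate i1.1 n).mul (aestronglyMeasurable_truncate i2.1 n))
      i3.abs
      (fun n => .of_forall fun q => by
        rw [Real.norm_eq_abs, abs_mul, abs_mul]
        exact mul_le_mul (abs_truncate_le _ n) (abs_truncate_le _ n) (abs_nonneg _)
          (abs_nonneg _))
      (.of_forall fun q => (tendsto_truncate _).mul (tendsto_truncate _))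
  refine le_of_tendsto_of_tendsto'
    ((tendsto_integral_truncate i1).mul (tendsto_integral_truncate i2)) hlim fun n => ?_
  exact h.integral_mul_le_of_bddBelow (monotone_truncate hF n) (monotone_truncate hG n)
    (iF.of_le (aestronglyMeasurable_truncate i1.1 n) (.of_forall fun _ => abs_truncate_le _ n))
    (iG.of_le (aestronglyMeasurable_truncate i2.1 n) (.of_forall fun _ => abs_truncate_le _ n))
    (fun q => le_max_right _ _) fun q => le_max_right _ _

end Correlation

/-! ### The single-site measure -/

section SingleSite

theorem measurable_nnabs : Measurable fun t : ℝ => Real.nnabs t :=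
  have h : Continuous fun t : ℝ => Real.nnabs t :=
    continuous_abs.subtype_mk fun t => abs_nonneg t
  h.measurable

theorem integrable_exp_quartic {g : ℝ} (hg : 0 < g) (K : ℝ) :
    Integrable fun t : ℝ => Real.exp (-g * t ^ 4 + K * t ^ 2) := by
  -- Completing the square in t², the maximum of (K + 1) t² - g t⁴ over all real t² is (K + 1)² /
  -- (4g), so a Gaussian dominates.
  refine ((integrable_exp_neg_mul_sq one_pos).const_mul
    (Real.exp ((K + 1) ^ 2 / (4 * g)))).mono' (by fun_prop) (.of_forall fun t => ?_)
  rw [Real.norm_of_nonneg (Real.exp_pos _).le, ← Real.exp_add, Real.exp_le_exp]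
  have h1 : (K + 1) ^ 2 / (4 * g) - (K + 1) * t ^ 2 + g * t ^ 4 =
      ((K + 1) - 2 * g * t ^ 2) ^ 2 / (4 * g) := by field_simp; ring
  have h2 : 0 ≤ ((K + 1) - 2 * g * t ^ 2) ^ 2 / (4 * g) := by positivity
  nlinarith

theorem isProbabilityMeasure_singleSite {g : ℝ} (hg : 0 < g) (a : ℝ) :
    IsProbabilityMeasure (singleSite g a) := by
  have hi := integrable_exp_quartic hg (-a)
  refine isProbabilityMeasure_normalize ?_ ?_
  · rw [withDensity_apply _ MeasurableSet.univ, Measure.restrict_univ]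
    refine (lintegral_pos_iff_support (by fun_prop)).2 ?_ |>.ne'
    have hs : (Function.support fun t : ℝ =>
        ENNReal.ofReal (Real.exp (-g * t ^ 4 - a * t ^ 2))) = Set.univ :=
      Function.support_eq_univ fun t => by simpa using Real.exp_pos _
    rw [hs]
    simp
  · rw [withDensity_apply _ MeasurableSet.univ, Measure.restrict_univ]
    convert hi.lintegral_lt_top.ne using 6
    ring

theorem isProbabilityMeasure_absSingleSite {g : ℝ} (hg : 0 < g) (a : ℝ) :
    IsProbabilityMeasure (absSingleSite g a) :=
  have := isProbabilityMeasure_singleSite hg a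
  Measure.isProbabilityMeasure_map measurable_nnabs.aemeasurable

/-- The couplings grow quadratically in the field, with arbitrary constants; the quartic term
absorbs them for every β. -/
theorem integrable_exp_sq_absSingleSite {g : ℝ} (hg : 0 < g) (a C : ℝ) :
    Integrable (fun t : ℝ≥0 => Real.exp (C * (t : ℝ) ^ 2)) (absSingleSite g a) := by
  have := isProbabilityMeasure_singleSite hg a
  rw [absSingleSite, integrable_map_measure (by fun_prop) measurable_nnabs.aemeasurable]
  have h0 : (volume.withDensity fun t : ℝ =>
      ENNReal.ofReal (Real.exp (-g * t ^ 4 - a * t ^ 2))) Set.univ ≠ 0 := fun h0 => by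
    have h1 : singleSite g a = 0 := by
      rw [singleSite, Measure.measure_univ_eq_zero.1 h0]; simp [normalize]
    exact IsProbabilityMeasure.ne_zero _ h1
  refine Integrable.smul_measure ?_ (ENNReal.inv_ne_top.2 h0)
  rw [integrable_withDensity_iff (by fun_prop) (.of_forall fun _ => ENNReal.ofReal_lt_top)]
  refine (integrable_exp_quartic hg (C - a)).congr (.of_forall fun t => ?_)
  simp only [Function.comp_apply, Real.coe_nnabs, sq_abs]
  rw [ENNReal.toReal_ofReal (Real.exp_pos _).le, ← Real.exp_add]
  congr 1
  ring

end SingleSite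

end Phi4RC

namespace Phi4RC

/-! ### The field with prescribed values -/

section Field

variable {d : ℕ} {Λ : Finset (Fin d → ℤ)}

open Classical in
/-- The field which agrees with `η` on `A`, with `b` on `∂ᵉˣᵗ Λ`, and with `s` elsewhere. -/
noncomputable def overwrite (b : extBoundary Λ → ℝ≥0) (A : Finset (Fin d → ℤ)) (η : A → ℝ≥0)
    (s : AbsField Λ) : AbsField Λ := fun x =>
  if hA : (x : Fin d → ℤ) ∈ A then η ⟨x, hA⟩
  else if hx : (x : Fin d → ℤ) ∈ Λ then s x
  else b ⟨x, mem_extBoundary_of_notMem x.2 hx⟩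

/-- For ordered data, overwriting is compatible with the lattice operations. Measures with different
prescribed values can thus be compared over the same free field. -/
theorem overwrite_sup {b₁ b₂ : extBoundary Λ → ℝ≥0} (hb : b₁ ≤ b₂) {A : Finset (Fin d → ℤ)}
    {η₁ η₂ : A → ℝ≥0} (hη : η₁ ≤ η₂) (s t : AbsField Λ) :
    overwrite b₁ A η₁ s ⊔ overwrite b₂ A η₂ t = overwrite b₂ A η₂ (s ⊔ t) := by
  ext x
  simp only [overwrite, Pi.sup_apply]
  split_ifs with hA hx
  · rw [sup_eq_right.2 (hη _)]
  · rfl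
  · rw [sup_eq_right.2 (hb _)]

theorem overwrite_inf {b₁ b₂ : extBoundary Λ → ℝ≥0} (hb : b₁ ≤ b₂) {A : Finset (Fin d → ℤ)}
    {η₁ η₂ : A → ℝ≥0} (hη : η₁ ≤ η₂) (s t : AbsField Λ) :
    overwrite b₁ A η₁ s ⊓ overwrite b₂ A η₂ t = overwrite b₁ A η₁ (s ⊓ t) := by
  ext x
  simp only [overwrite, Pi.inf_apply]
  split_ifs with hA hx
  · rw [inf_eq_left.2 (hη _)]
  · rfl
  · rw [inf_eq_left.2 (hb _)]

theorem measurable_overwrite_uncurry (b : extBoundary Λ → ℝ≥0) (A : Finset (Fin d → ℤ)) :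
    Measurable fun p : (A → ℝ≥0) × AbsField Λ => overwrite b A p.1 p.2 := by
  refine measurable_pi_lambda _ fun x => ?_
  by_cases hA : (x : Fin d → ℤ) ∈ A
  · simp only [overwrite, hA, dif_pos]
    fun_prop
  · by_cases hx : (x : Fin d → ℤ) ∈ Λ
    · simp only [overwrite, hA, hx, dif_neg, dif_pos, not_false_eq_true]
      fun_prop
    · simp only [overwrite, hA, hx, dif_neg, not_false_eq_true]
      fun_prop

theorem measurable_overwrite (b : extBoundary Λ → ℝ≥0) (A : Finset (Fin d → ℤ)) (η : A → ℝ≥0) :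
    Measurable (overwrite b A η) :=
  (measurable_overwrite_uncurry b A).comp measurable_prodMk_left

/-- Independent sites in `Λ̄` with law `|·|_* ρ_{g,a}`. -/
noncomputable def freeField (g a : ℝ) (Λ : Finset (Fin d → ℤ)) : Measure (AbsField Λ) :=
  Measure.pi fun _ => absSingleSite g a

theorem map_overwrite {g : ℝ} (hg : 0 < g) (a : ℝ) (b : extBoundary Λ → ℝ≥0)
    (A : Finset (Fin d → ℤ)) (η : A → ℝ≥0) :
    (freeField g a Λ).map (overwrite b A η) = fieldRefGiven g a b A η := by
  classical
  have := isProbabilityMeasure_absSingleSite hg a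
  set f : closedVolume Λ → ℝ≥0 → ℝ≥0 := fun x t =>
    if hA : (x : Fin d → ℤ) ∈ A then η ⟨x, hA⟩
    else if hx : (x : Fin d → ℤ) ∈ Λ then t
    else b ⟨x, mem_extBoundary_of_notMem x.2 hx⟩ with hf
  have hm : ∀ x, Measurable (f x) := fun x => by
    simp only [hf]
    split_ifs <;> fun_prop
  have := fun x => Measure.isProbabilityMeasure_map (μ := absSingleSite g a) (hm x).aemeasurable
  have h := Measure.pi_map_pi (μ := fun _ : closedVolume Λ => absSingleSite g a) (f := f)
    fun x => (hm x).aemeasurable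
  refine Eq.trans (by rfl) (h.trans ?_)
  rw [fieldRefGiven]
  congr 1
  ext1 x
  simp only [hf]
  split_ifs with hA hx
  · simp [Measure.map_const]
  · exact Measure.map_id
  · simp [Measure.map_const]

theorem fieldRef_eq (g a : ℝ) (b : extBoundary Λ → ℝ≥0)
    (η : (∅ : Finset (Fin d → ℤ)) → ℝ≥0) : fieldRef g a b = fieldRefGiven g a b ∅ η := by
  simp [fieldRef, fieldRefGiven]

/-- Reduces the unconditioned claims to the conditional ones with A = ∅. -/
theorem phi4RC_eq (g a β : ℝ) (h : Λ → ℝ≥0) (ξ : Setoid (extBoundary Λ))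
    (b : extBoundary Λ → ℝ≥0) (η : (∅ : Finset (Fin d → ℤ)) → ℝ≥0) :
    phi4RC g a β h ξ b = phi4RCGiven g a β h ξ b ∅ η := by
  rw [phi4RC, phi4RCGiven, fieldRef_eq]

theorem measurable_coupling (β : ℝ) (h : Λ → ℝ≥0) (i : edges Λ ⊕ Λ) :
    Measurable fun s => coupling β h s i := by
  rcases i with ⟨e, he⟩ | x
  · induction e using Sym2.ind with
    | _ x y =>
      simp only [coupling, Sym2.map_mk, Sym2.mul_mk]
      fun_prop
  · simp only [coupling]
    fun_prop

theorem measurable_weight (β : ℝ) (h : Λ → ℝ≥0) (ξ : Setoid (extBoundary Λ)) :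
    Measurable (weight β h ξ) := by
  refine measurable_from_prod_countable_right fun ω => ?_
  simp_rw [weight_eq, rcWeight]
  refine (Finset.measurable_fun_prod _ fun i _ => ?_).mul_const _
  have := measurable_coupling β h i
  simp only [bondFactor]
  split_ifs <;> fun_prop

theorem measurable_weight_overwrite (β : ℝ) (h : Λ → ℝ≥0) (ξ : Setoid (extBoundary Λ))
    (b : extBoundary Λ → ℝ≥0) (A : Finset (Fin d → ℤ)) (η : A → ℝ≥0) (ω : Config Λ) :
    Measurable fun s => ENNReal.ofReal (weight β h ξ (ω, overwrite b A η s)) :=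
  ((measurable_weight β h ξ).comp
    (measurable_prodMk_left.comp (measurable_overwrite b A η))).ennreal_ofReal

theorem bondFactor_le_exp {J : ℝ} (hJ : 0 ≤ J) (o : Bool) : bondFactor J o ≤ Real.exp J := by
  unfold bondFactor
  split_ifs
  · linarith [Real.exp_pos (-J)]
  · exact Real.exp_le_exp.2 (by linarith)

theorem coupling_le {β : ℝ} (hβ : 0 ≤ β) (h : Λ → ℝ≥0) (s : AbsField Λ) (i : edges Λ ⊕ Λ) :
    coupling β h s i ≤ β * (1 + ∑ x, (h x : ℝ)) * (1 + ∑ x, (s x : ℝ) ^ 2) := by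
  have hs : ∀ x, (s x : ℝ) ^ 2 ≤ ∑ x, (s x : ℝ) ^ 2 := fun x =>
    Finset.single_le_sum (f := fun x => (s x : ℝ) ^ 2) (fun _ _ => by positivity)
      (Finset.mem_univ x)
  have hS : 0 ≤ ∑ x, (s x : ℝ) ^ 2 := Finset.sum_nonneg fun _ _ => by positivity
  have hH : 0 ≤ ∑ x, (h x : ℝ) := Finset.sum_nonneg fun _ _ => by positivity
  rcases i with ⟨e, he⟩ | x
  · induction e using Sym2.ind with
    | _ x y =>
      simp only [coupling, Sym2.map_mk, Sym2.mul_mk, NNReal.coe_mul]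
      rw [mul_assoc]
      refine mul_le_mul_of_nonneg_left ?_ hβ
      nlinarith [hs x, hs y, sq_nonneg ((s x : ℝ) - s y), mul_nonneg hH hS]
  · simp only [coupling]
    rw [mul_assoc, mul_assoc]
    refine mul_le_mul_of_nonneg_left ?_ hβ
    have hh : (h x : ℝ) ≤ ∑ x, (h x : ℝ) :=
      Finset.single_le_sum (f := fun x => (h x : ℝ)) (fun _ _ => by positivity)
        (Finset.mem_univ x)
    refine mul_le_mul (by linarith) ?_ (by positivity) (by linarith)
    nlinarith [hs ⟨x, mem_closedVolume_of_mem x.2⟩,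
      sq_nonneg ((s ⟨x, mem_closedVolume_of_mem x.2⟩ : ℝ) - 1)]

theorem exists_weight_overwrite_le {β : ℝ} (hβ : 0 ≤ β) (h : Λ → ℝ≥0)
    (ξ : Setoid (extBoundary Λ)) (b : extBoundary Λ → ℝ≥0) (A : Finset (Fin d → ℤ))
    (η : A → ℝ≥0) (ω : Config Λ) :
    ∃ C D : ℝ, ∀ s, weight β h ξ (ω, overwrite b A η s) ≤
      C * ∏ x, Real.exp (D * (s x : ℝ) ^ 2) := by
  set n := Fintype.card (edges Λ ⊕ Λ)
  set c := β * (1 + ∑ x, (h x : ℝ)) with hc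
  -- The sum of squares of the prescribed values, since the remaining sites carry 0.
  set m := ∑ x, (overwrite b A η 0 x : ℝ) ^ 2
  refine ⟨Real.exp (n * (c * (1 + m))) * Nat.card (satisfying edgeChar (constantOn ξ) ω),
    n * c, fun s => ?_⟩
  have hc0 : 0 ≤ c := mul_nonneg hβ (by positivity)
  have hsum : ∑ x, (overwrite b A η s x : ℝ) ^ 2 ≤ m + ∑ x, (s x : ℝ) ^ 2 := by
    rw [← Finset.sum_add_distrib]
    refine Finset.sum_le_sum fun x _ => ?_
    simp only [overwrite]
    split_ifs <;> simp
  rw [weight_eq, rcWeight, ← Real.exp_sum, ← Finset.mul_sum, mul_right_comm]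
  refine mul_le_mul_of_nonneg_right ?_ (Nat.cast_nonneg _)
  have hJ := coupling_nonneg hβ h (overwrite b A η s)
  calc ∏ i, bondFactor (coupling β h (overwrite b A η s) i) (ω i)
      ≤ ∏ i : edges Λ ⊕ Λ, Real.exp (c * (1 + ∑ x, (overwrite b A η s x : ℝ) ^ 2)) :=
        Finset.prod_le_prod (fun i _ => bondFactor_nonneg (hJ i) _) fun i _ =>
          (bondFactor_le_exp (hJ i) _).trans (Real.exp_le_exp.2 (coupling_le hβ h _ i))
    _ = Real.exp (n * (c * (1 + ∑ x, (overwrite b A η s x : ℝ) ^ 2))) := by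
        rw [← Real.exp_sum, Finset.sum_const, nsmul_eq_mul, Finset.card_univ]
    _ ≤ Real.exp (n * (c * (1 + (m + ∑ x, (s x : ℝ) ^ 2)))) := by gcongr
    _ = _ := by rw [← Real.exp_add]; congr 1; ring

theorem lintegral_weight_overwrite_lt_top {g : ℝ} (hg : 0 < g) (a : ℝ) {β : ℝ} (hβ : 0 ≤ β)
    (h : Λ → ℝ≥0) (ξ : Setoid (extBoundary Λ)) (b : extBoundary Λ → ℝ≥0)
    (A : Finset (Fin d → ℤ)) (η : A → ℝ≥0) (ω : Config Λ) :
    ∫⁻ s, ENNReal.ofReal (weight β h ξ (ω, overwrite b A η s)) ∂freeField g a Λ < ∞ := by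
  have := isProbabilityMeasure_absSingleSite hg a
  obtain ⟨C, D, hCD⟩ := exists_weight_overwrite_le hβ h ξ b A η ω
  have hi : Integrable (fun s : AbsField Λ => C * ∏ x, Real.exp (D * (s x : ℝ) ^ 2))
      (freeField g a Λ) :=
    (Integrable.fintype_prod (𝕜 := ℝ) (f := fun (_ : closedVolume Λ) (t : ℝ≥0) =>
      Real.exp (D * (t : ℝ) ^ 2)) fun _ => integrable_exp_sq_absSingleSite hg a D).const_mul C
  exact (lintegral_mono fun s => ENNReal.ofReal_le_ofReal (hCD s)).trans_lt hi.lintegral_lt_top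

/-- The random cluster measure before normalisation. -/
noncomputable def rawMeasure (g a : ℝ) (β : ℝ) (h : Λ → ℝ≥0) (ξ : Setoid (extBoundary Λ))
    (b : extBoundary Λ → ℝ≥0) (A : Finset (Fin d → ℤ)) (η : A → ℝ≥0) :
    Measure (Config Λ × AbsField Λ) :=
  (Measure.count.prod (fieldRefGiven g a b A η)).withDensity
    fun q => ENNReal.ofReal (weight β h ξ q)

theorem isProbabilityMeasure_freeField {g : ℝ} (hg : 0 < g) (a : ℝ) :
    IsProbabilityMeasure (freeField g a Λ) :=
  have := isProbabilityMeasure_absSingleSite hg a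
  Measure.pi.instIsProbabilityMeasure _

theorem isProbabilityMeasure_fieldRefGiven {g : ℝ} (hg : 0 < g) (a : ℝ)
    (b : extBoundary Λ → ℝ≥0) (A : Finset (Fin d → ℤ)) (η : A → ℝ≥0) :
    IsProbabilityMeasure (fieldRefGiven g a b A η) := by
  have := isProbabilityMeasure_freeField (Λ := Λ) hg a
  rw [← map_overwrite hg]
  exact Measure.isProbabilityMeasure_map (measurable_overwrite b A η).aemeasurable

/-! ### Integration against the unnormalised measure and its total mass -/

section Raw

variable {g : ℝ} (hg : 0 < g) (a β : ℝ) (h : Λ → ℝ≥0) (ξ : Setoid (extBoundary Λ))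
  (b : extBoundary Λ → ℝ≥0) (A : Finset (Fin d → ℤ)) (η : A → ℝ≥0)

-- Where the weight vanishes Φ is uncontrolled, so only its product with the weight is measurable.
-- Null sets of the counting measure are empty, so this holds for every ω.
include hg in
theorem aemeasurable_slice_rawMeasure {Φ : Config Λ × AbsField Λ → ℝ≥0∞}
    (hΦ : AEMeasurable Φ (rawMeasure g a β h ξ b A η)) (ω : Config Λ) :
    AEMeasurable (fun s => ENNReal.ofReal (weight β h ξ (ω, s)) * Φ (ω, s))
      (fieldRefGiven g a b A η) := by
  have := isProbabilityMeasure_fieldRefGiven hg a b A η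
  have h1 := (aemeasurable_withDensity_ennreal_iff
    (measurable_weight β h ξ).real_toNNReal).1 hΦ
  exact Measure.ae_count_iff.1 (ae_aemeasurable_slice h1) ω

include hg in
theorem aemeasurable_overwrite {Φ : Config Λ × AbsField Λ → ℝ≥0∞}
    (hΦ : AEMeasurable Φ (rawMeasure g a β h ξ b A η)) (ω : Config Λ) :
    AEMeasurable (fun s => ENNReal.ofReal (weight β h ξ (ω, overwrite b A η s)) *
      Φ (ω, overwrite b A η s)) (freeField g a Λ) := by
  have h1 := aemeasurable_slice_rawMeasure hg a β h ξ b A η hΦ ω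
  rw [← map_overwrite hg] at h1
  exact h1.comp_measurable (measurable_overwrite b A η)

include hg in
theorem lintegral_rawMeasure {Φ : Config Λ × AbsField Λ → ℝ≥0∞}
    (hΦ : AEMeasurable Φ (rawMeasure g a β h ξ b A η)) :
    ∫⁻ q, Φ q ∂rawMeasure g a β h ξ b A η =
      ∫⁻ s, ∑ ω, ENNReal.ofReal (weight β h ξ (ω, overwrite b A η s)) *
        Φ (ω, overwrite b A η s) ∂freeField g a Λ := by
  have := isProbabilityMeasure_fieldRefGiven hg a b A η
  have h1 : AEMeasurable (fun q => ENNReal.ofReal (weight β h ξ q) * Φ q)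
      (Measure.count.prod (fieldRefGiven g a b A η)) :=
    (aemeasurable_withDensity_ennreal_iff (measurable_weight β h ξ).real_toNNReal).1 hΦ
  have h2 := fun ω => aemeasurable_slice_rawMeasure hg a β h ξ b A η hΦ ω
  rw [rawMeasure, lintegral_withDensity_eq_lintegral_mul₀'
    (measurable_weight β h ξ).ennreal_ofReal.aemeasurable hΦ]
  simp only [Pi.mul_apply]
  rw [lintegral_prod_symm _ h1]
  simp only [lintegral_count, tsum_fintype]
  have h3 := Finset.aemeasurable_fun_sum Finset.univ fun ω _ => h2 ω
  rw [← map_overwrite hg] at h3 ⊢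
  rw [lintegral_map' h3 (measurable_overwrite b A η).aemeasurable]

include hg in
theorem rawMeasure_univ_ne_zero : rawMeasure g a β h ξ b A η Set.univ ≠ 0 := by
  have := isProbabilityMeasure_freeField (Λ := Λ) hg a
  rw [← lintegral_one, lintegral_rawMeasure hg a β h ξ b A η aemeasurable_const]
  have hm : Measurable fun s => ∑ ω, ENNReal.ofReal (weight β h ξ (ω, overwrite b A η s)) * 1 :=
    Finset.measurable_fun_sum _ fun ω _ =>
      (measurable_weight_overwrite β h ξ b A η ω).mul_const 1
  intro h0
  obtain ⟨s, hs⟩ := ((lintegral_eq_zero_iff hm).1 h0).exists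
  simp only [mul_one, Pi.zero_apply, Finset.sum_eq_zero_iff, Finset.mem_univ, true_imp_iff,
    ENNReal.ofReal_eq_zero] at hs
  exact (sum_weight_pos β h ξ (overwrite b A η s)).not_ge (Finset.sum_nonpos fun ω _ => hs ω)

include hg in
theorem rawMeasure_univ_ne_top {β : ℝ} (hβ : 0 ≤ β) :
    rawMeasure g a β h ξ b A η Set.univ ≠ ∞ := by
  rw [← lintegral_one, lintegral_rawMeasure hg a β h ξ b A η aemeasurable_const]
  simp only [mul_one]
  rw [lintegral_finsetSum _ fun ω _ => measurable_weight_overwrite β h ξ b A η ω]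
  exact (ENNReal.sum_lt_top.2 fun ω _ =>
    lintegral_weight_overwrite_lt_top hg a hβ h ξ b A η ω).ne

include hg in
theorem isProbabilityMeasure_phi4RCGiven {β : ℝ} (hβ : 0 ≤ β) :
    IsProbabilityMeasure (phi4RCGiven g a β h ξ b A η) :=
  isProbabilityMeasure_normalize (rawMeasure_univ_ne_zero hg a β h ξ b A η)
    (rawMeasure_univ_ne_top hg a h ξ b A η hβ)

end Raw

end Field

end Phi4RC

namespace Phi4RC

/-! ### Comparison of random cluster measures -/

section Main

variable {d : ℕ} {Λ : Finset (Fin d → ℤ)}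

theorem sum_ofReal_weight_mul {β : ℝ} (hβ : 0 ≤ β) (h : Λ → ℝ≥0) (ξ : Setoid (extBoundary Λ))
    (s : AbsField Λ) {F : Config Λ × AbsField Λ → ℝ} (hF : 0 ≤ F) :
    ∑ ω, ENNReal.ofReal (weight β h ξ (ω, s)) * ENNReal.ofReal (F (ω, s)) =
      ENNReal.ofReal (∑ ω, F (ω, s) * weight β h ξ (ω, s)) := by
  rw [ENNReal.ofReal_sum_of_nonneg fun ω _ => mul_nonneg (hF _) (weight_nonneg hβ h ξ _)]
  refine Finset.sum_congr rfl fun ω _ => ?_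
  rw [mul_comm, ENNReal.ofReal_mul (hF _)]

/-- The four functions theorem over the free field, applied to the sums over ω; its pointwise
hypothesis is `sum_mul_weight_mul_le_sup` at the overwritten fields. -/
theorem lintegral_rawMeasure_mul_le {g : ℝ} (hg : 0 < g) (a : ℝ) {β₁ β₂ : ℝ} (hβ₁ : 0 ≤ β₁)
    (hβ : β₁ ≤ β₂) {h₁ h₂ : Λ → ℝ≥0} (hh : h₁ ≤ h₂) {ξ₁ ξ₂ : Setoid (extBoundary Λ)}
    (hξ : ξ₁ ≤ ξ₂) {b₁ b₂ : extBoundary Λ → ℝ≥0} (hb : b₁ ≤ b₂) (A : Finset (Fin d → ℤ))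
    {η₁ η₂ : A → ℝ≥0} (hη : η₁ ≤ η₂) {F G : Config Λ × AbsField Λ → ℝ} (hF : 0 ≤ F)
    (hFm : Monotone F) (hG : 0 ≤ G) (hGm : Monotone G)
    (hF₁ : AEMeasurable F (rawMeasure g a β₁ h₁ ξ₁ b₁ A η₁))
    (hF₂ : AEMeasurable F (rawMeasure g a β₂ h₂ ξ₂ b₂ A η₂))
    (hG₂ : AEMeasurable G (rawMeasure g a β₂ h₂ ξ₂ b₂ A η₂)) :
    (∫⁻ q, ENNReal.ofReal (F q) ∂rawMeasure g a β₁ h₁ ξ₁ b₁ A η₁) *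
        ∫⁻ q, ENNReal.ofReal (G q) ∂rawMeasure g a β₂ h₂ ξ₂ b₂ A η₂ ≤
      rawMeasure g a β₁ h₁ ξ₁ b₁ A η₁ Set.univ *
        ∫⁻ q, ENNReal.ofReal (F q * G q) ∂rawMeasure g a β₂ h₂ ξ₂ b₂ A η₂ := by
  have hβ₂ := hβ₁.trans hβ
  have := isProbabilityMeasure_absSingleSite hg a
  have hone : AEMeasurable (fun q => ENNReal.ofReal ((1 : Config Λ × AbsField Λ → ℝ) q))
      (rawMeasure g a β₁ h₁ ξ₁ b₁ A η₁) := by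
    simp only [Pi.one_apply]
    exact aemeasurable_const
  have h1 : rawMeasure g a β₁ h₁ ξ₁ b₁ A η₁ Set.univ =
      ∫⁻ q, ENNReal.ofReal ((1 : Config Λ × AbsField Λ → ℝ) q)
        ∂rawMeasure g a β₁ h₁ ξ₁ b₁ A η₁ := by simp
  have mFG : AEMeasurable (fun q => ENNReal.ofReal (F q * G q))
      (rawMeasure g a β₂ h₂ ξ₂ b₂ A η₂) := (hF₂.mul hG₂).ennreal_ofReal
  have m1 := fun ω => aemeasurable_overwrite hg a β₁ h₁ ξ₁ b₁ A η₁ hF₁.ennreal_ofReal ω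
  have m2 := fun ω => aemeasurable_overwrite hg a β₂ h₂ ξ₂ b₂ A η₂ hG₂.ennreal_ofReal ω
  have m3 := fun ω => aemeasurable_overwrite hg a β₁ h₁ ξ₁ b₁ A η₁ hone ω
  have m4 := fun ω => aemeasurable_overwrite hg a β₂ h₂ ξ₂ b₂ A η₂ mFG ω
  have hFG : 0 ≤ fun q => F q * G q := fun q => mul_nonneg (hF q) (hG q)
  rw [h1, lintegral_rawMeasure hg a β₁ h₁ ξ₁ b₁ A η₁ hF₁.ennreal_ofReal,
    lintegral_rawMeasure hg a β₂ h₂ ξ₂ b₂ A η₂ hG₂.ennreal_ofReal,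
    lintegral_rawMeasure hg a β₁ h₁ ξ₁ b₁ A η₁ hone,
    lintegral_rawMeasure hg a β₂ h₂ ξ₂ b₂ A η₂ mFG]
  refine fourFunctions_pi (absSingleSite g a) _ _ _ _
    (Finset.aemeasurable_fun_sum _ fun ω _ => m1 ω) (Finset.aemeasurable_fun_sum _ fun ω _ => m2 ω)
    (Finset.aemeasurable_fun_sum _ fun ω _ => m3 ω) (Finset.aemeasurable_fun_sum _ fun ω _ => m4 ω)
    Set.univ (by simp) fun s _ t _ _ _ => ?_
  simp only [sum_ofReal_weight_mul hβ₁ h₁ ξ₁ _ hF, sum_ofReal_weight_mul hβ₂ h₂ ξ₂ _ hG,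
    sum_ofReal_weight_mul hβ₁ h₁ ξ₁ _ (zero_le_one' (Config Λ × AbsField Λ → ℝ)),
    sum_ofReal_weight_mul hβ₂ h₂ ξ₂ _ hFG]
  simp only [Pi.one_apply, one_mul]
  rw [← ENNReal.ofReal_mul (Finset.sum_nonneg fun ω _ =>
      mul_nonneg (hF _) (weight_nonneg hβ₁ _ _ _)),
    ← ENNReal.ofReal_mul (Finset.sum_nonneg fun ω _ => weight_nonneg hβ₁ _ _ _)]
  refine ENNReal.ofReal_le_ofReal ?_
  rw [← overwrite_inf hb hη, ← overwrite_sup hb hη]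
  exact sum_mul_weight_mul_le_sup hβ₁ hβ hh hξ _ _ hF hFm hG hGm

theorem correlated_phi4RCGiven {g : ℝ} (hg : 0 < g) (a : ℝ) {β₁ β₂ : ℝ} (hβ₁ : 0 ≤ β₁)
    (hβ : β₁ ≤ β₂) {h₁ h₂ : Λ → ℝ≥0} (hh : h₁ ≤ h₂) {ξ₁ ξ₂ : Setoid (extBoundary Λ)}
    (hξ : ξ₁ ≤ ξ₂) {b₁ b₂ : extBoundary Λ → ℝ≥0} (hb : b₁ ≤ b₂) (A : Finset (Fin d → ℤ))
    {η₁ η₂ : A → ℝ≥0} (hη : η₁ ≤ η₂) :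
    Correlated (phi4RCGiven g a β₁ h₁ ξ₁ b₁ A η₁) (phi4RCGiven g a β₂ h₂ ξ₂ b₂ A η₂) := by
  intro F G hF hFm hG hGm hF₁ hF₂ hG₂
  have t1 := rawMeasure_univ_ne_top hg a h₁ ξ₁ b₁ A η₁ hβ₁
  have z1 := rawMeasure_univ_ne_zero hg a β₁ h₁ ξ₁ b₁ A η₁
  have t2 := rawMeasure_univ_ne_top hg a h₂ ξ₂ b₂ A η₂ (hβ₁.trans hβ)
  have e1 : phi4RCGiven g a β₁ h₁ ξ₁ b₁ A η₁ = (rawMeasure g a β₁ h₁ ξ₁ b₁ A η₁ Set.univ)⁻¹ •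
    rawMeasure g a β₁ h₁ ξ₁ b₁ A η₁ := rfl
  have e2 : phi4RCGiven g a β₂ h₂ ξ₂ b₂ A η₂ = (rawMeasure g a β₂ h₂ ξ₂ b₂ A η₂ Set.univ)⁻¹ •
    rawMeasure g a β₂ h₂ ξ₂ b₂ A η₂ := rfl
  rw [e1, aemeasurable_smul_measure_iff (ENNReal.inv_ne_zero.2 t1)] at hF₁
  rw [e2, aemeasurable_smul_measure_iff (ENNReal.inv_ne_zero.2 t2)] at hF₂ hG₂
  have key := lintegral_rawMeasure_mul_le hg a hβ₁ hβ hh hξ hb A hη hF hFm hG hGm hF₁ hF₂ hG₂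
  rw [e1, e2]
  simp only [lintegral_smul_measure, smul_eq_mul]
  generalize rawMeasure g a β₁ h₁ ξ₁ b₁ A η₁ Set.univ = Z₁ at *
  generalize (rawMeasure g a β₂ h₂ ξ₂ b₂ A η₂ Set.univ)⁻¹ = c at *
  calc _ = Z₁⁻¹ * c * ((∫⁻ q, ENNReal.ofReal (F q) ∂rawMeasure g a β₁ h₁ ξ₁ b₁ A η₁) *
        ∫⁻ q, ENNReal.ofReal (G q) ∂rawMeasure g a β₂ h₂ ξ₂ b₂ A η₂) := by ring
    _ ≤ Z₁⁻¹ * c * (Z₁ *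
        ∫⁻ q, ENNReal.ofReal (F q * G q) ∂rawMeasure g a β₂ h₂ ξ₂ b₂ A η₂) :=
      mul_le_mul_right key _
    _ = (Z₁⁻¹ * Z₁) * (c *
        ∫⁻ q, ENNReal.ofReal (F q * G q) ∂rawMeasure g a β₂ h₂ ξ₂ b₂ A η₂) := by ring
    _ = _ := by rw [ENNReal.inv_mul_cancel z1 t1, one_mul]

/-! ### Conditioning on the field in a subset -/

open Classical in
/-- The field equal to `s` on `A` and to `t` elsewhere. -/
noncomputable def mix (A : Finset (Fin d → ℤ)) (p : AbsField Λ × AbsField Λ) : AbsField Λ :=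
  fun x => if (x : Fin d → ℤ) ∈ A then p.1 x else p.2 x

/-- The sites are independent, so resampling those off A keeps the law; on boxes both sides
factorise. -/
theorem measurePreserving_mix {g : ℝ} (hg : 0 < g) (a : ℝ) (A : Finset (Fin d → ℤ)) :
    MeasurePreserving (mix A) ((freeField g a Λ).prod (freeField g a Λ)) (freeField g a Λ) := by
  classical
  have := isProbabilityMeasure_absSingleSite hg a
  have := isProbabilityMeasure_freeField (Λ := Λ) hg a
  have hm : Measurable (mix A (Λ := Λ)) := by
    refine measurable_pi_lambda _ fun x => ?_
    simp only [mix]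
    split_ifs <;> fun_prop
  refine ⟨hm, (Measure.pi_eq fun S hS => ?_).symm⟩
  rw [Measure.map_apply hm (MeasurableSet.univ_pi hS)]
  have e : mix A ⁻¹' Set.univ.pi S =
      (Set.univ.pi fun x : closedVolume Λ => if (x : Fin d → ℤ) ∈ A then S x else Set.univ) ×ˢ
      (Set.univ.pi fun x : closedVolume Λ => if (x : Fin d → ℤ) ∈ A then Set.univ else S x) := by
    ext p
    simp only [Set.mem_preimage, Set.mem_pi, Set.mem_univ, true_imp_iff, Set.mem_prod, mix,
      ← forall_and]
    refine forall_congr' fun x => ?_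
    split_ifs <;> simp
  rw [e, Measure.prod_prod, freeField, Measure.pi_pi, Measure.pi_pi, ← Finset.prod_mul_distrib]
  refine Finset.prod_congr rfl fun x _ => ?_
  split_ifs <;> simp

/-- The mass that the unnormalised conditional measure gives to `Φ`. -/
noncomputable def slice (g a β : ℝ) (h : Λ → ℝ≥0) (ξ : Setoid (extBoundary Λ))
    (b : extBoundary Λ → ℝ≥0) (A : Finset (Fin d → ℤ)) (Φ : Config Λ × AbsField Λ → ℝ≥0∞)
    (η : A → ℝ≥0) : ℝ≥0∞ := ∫⁻ q, Φ q ∂rawMeasure g a β h ξ b A η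

section Disintegration

variable {g : ℝ} (hg : 0 < g) (a β : ℝ) (h : Λ → ℝ≥0) (ξ : Setoid (extBoundary Λ))
  (b : extBoundary Λ → ℝ≥0) (A : Finset (Fin d → ℤ))

include hg in
theorem measurable_slice {Φ : Config Λ × AbsField Λ → ℝ≥0∞} (hΦ : Measurable Φ) :
    Measurable (slice g a β h ξ b A Φ) := by
  have := isProbabilityMeasure_freeField (Λ := Λ) hg a
  have e : slice g a β h ξ b A Φ = fun η => ∫⁻ s, ∑ ω,
      ENNReal.ofReal (weight β h ξ (ω, overwrite b A η s)) * Φ (ω, overwrite b A η s)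
        ∂freeField g a Λ :=
    funext fun η => lintegral_rawMeasure hg a β h ξ b A η hΦ.aemeasurable
  rw [e]
  refine Measurable.lintegral_prod_right' (f := fun p : (A → ℝ≥0) × AbsField Λ => ∑ ω,
    ENNReal.ofReal (weight β h ξ (ω, overwrite b A p.1 p.2)) * Φ (ω, overwrite b A p.1 p.2)) ?_
  refine Finset.measurable_fun_sum _ fun ω _ => ?_
  have hm : Measurable fun p : (A → ℝ≥0) × AbsField Λ => (ω, overwrite b A p.1 p.2) :=
    measurable_prodMk_left.comp (measurable_overwrite_uncurry b A)
  exact ((measurable_weight β h ξ).comp hm).ennreal_ofReal.mul (hΦ.comp hm)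

theorem fieldOn_overwrite {A : Finset (Fin d → ℤ)} (hA : A ⊆ Λ) (η : A → ℝ≥0) (ω : Config Λ)
    (s : AbsField Λ) : fieldOn hA (ω, overwrite b A η s) = η := by
  ext x
  simp [fieldOn, overwrite]

theorem overwrite_empty_mix {A : Finset (Fin d → ℤ)} (hA : A ⊆ Λ)
    (η : (∅ : Finset (Fin d → ℤ)) → ℝ≥0) (ω : Config Λ) (s t : AbsField Λ) :
    overwrite b ∅ η (mix A (s, t)) = overwrite b A (fieldOn hA (ω, s)) t := by
  ext x
  by_cases hx : (x : Fin d → ℤ) ∈ A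
  · simp [overwrite, mix, fieldOn, hx, hA hx]
  · simp [overwrite, mix, hx]

theorem measurable_fieldOn {A : Finset (Fin d → ℤ)} (hA : A ⊆ Λ) : Measurable (fieldOn hA) :=
  measurable_pi_lambda _ fun _ => (measurable_pi_apply _).comp measurable_snd

include hg in
/-- Resampling the field off `A` disintegrates the unnormalised measure. -/
theorem lintegral_mul_fieldOn {A : Finset (Fin d → ℤ)} (hA : A ⊆ Λ)
    (η : (∅ : Finset (Fin d → ℤ)) → ℝ≥0) {u : (A → ℝ≥0) → ℝ≥0∞} (hu : Measurable u)
    {Φ : Config Λ × AbsField Λ → ℝ≥0∞} (hΦ : Measurable Φ) (ω₀ : Config Λ) :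
    ∫⁻ q, u (fieldOn hA q) * Φ q ∂rawMeasure g a β h ξ b ∅ η =
      ∫⁻ s, u (fieldOn hA (ω₀, s)) * slice g a β h ξ b A Φ (fieldOn hA (ω₀, s))
        ∂freeField g a Λ := by
  have := isProbabilityMeasure_freeField (Λ := Λ) hg a
  have hm : Measurable fun q => u (fieldOn hA q) * Φ q :=
    (hu.comp (measurable_fieldOn hA)).mul hΦ
  have hs : Measurable fun s => ∑ ω, ENNReal.ofReal (weight β h ξ (ω, overwrite b ∅ η s)) *
      (u (fieldOn hA (ω, overwrite b ∅ η s)) * Φ (ω, overwrite b ∅ η s)) :=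
    Finset.measurable_fun_sum _ fun ω _ => (measurable_weight_overwrite β h ξ b ∅ η ω).mul
      (hm.comp (measurable_prodMk_left.comp (measurable_overwrite b ∅ η)))
  have hmix := measurePreserving_mix (Λ := Λ) hg a A
  have hs' := (hs.comp hmix.measurable).aemeasurable
    (μ := (freeField g a Λ).prod (freeField g a Λ))
  simp only [Function.comp_def] at hs'
  -- Sample the field as s on A and an independent t off A; the integral over t is then the slice at
  -- s|_A. The configuration ω₀ is a dummy, as `fieldOn` depends only on the field.
  rw [lintegral_rawMeasure hg a β h ξ b ∅ η hm.aemeasurable, ← hmix.lintegral_comp hs,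
    lintegral_prod _ hs']
  refine lintegral_congr fun s => ?_
  rw [slice, lintegral_rawMeasure hg a β h ξ b A _ hΦ.aemeasurable, ← lintegral_const_mul]
  · refine lintegral_congr fun t => ?_
    rw [Finset.mul_sum]
    refine Finset.sum_congr rfl fun ω _ => ?_
    rw [overwrite_empty_mix b hA η ω₀, fieldOn_overwrite]
    ring
  · exact Finset.measurable_fun_sum _ fun ω _ => (measurable_weight_overwrite β h ξ b A _ ω).mul
      (hΦ.comp (measurable_prodMk_left.comp (measurable_overwrite b A _)))

theorem phi4RCGiven_apply (η : A → ℝ≥0) {E : Set (Config Λ × AbsField Λ)}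
    (hE : MeasurableSet E) : phi4RCGiven g a β h ξ b A η E =
      (slice g a β h ξ b A 1 η)⁻¹ * slice g a β h ξ b A (E.indicator 1) η := by
  rw [slice, slice, lintegral_indicator_one hE]
  simp only [Pi.one_apply, lintegral_one]
  rfl

include hg in
theorem isRegularCondLaw_phi4RCGiven {β : ℝ} (hβ : 0 ≤ β) {A : Finset (Fin d → ℤ)}
    (hA : A ⊆ Λ) :
    IsRegularCondLaw (phi4RC g a β h ξ b) (fieldOn hA) (phi4RCGiven g a β h ξ b A) where
  measurable := by
    refine Measure.measurable_of_measurable_coe _ fun E hE => ?_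
    simp_rw [phi4RCGiven_apply a β h ξ b A _ hE]
    exact (measurable_slice hg a β h ξ b A measurable_one).inv.mul
      (measurable_slice hg a β h ξ b A (measurable_one.indicator hE))
  prob η := isProbabilityMeasure_phi4RCGiven hg a h ξ b A η hβ
  concentrated η := by
    have hE : MeasurableSet {q : Config Λ × AbsField Λ | fieldOn hA q ≠ η} :=
      (measurable_fieldOn hA (measurableSet_singleton η)).compl
    rw [phi4RCGiven_apply a β h ξ b A _ hE, slice, slice,
      lintegral_rawMeasure hg a β h ξ b A η (measurable_one.indicator hE).aemeasurable]
    simp [Set.indicator, fieldOn_overwrite]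
  disintegration E hE S hS := by
    obtain ⟨η⟩ : Nonempty ((∅ : Finset (Fin d → ℤ)) → ℝ≥0) := inferInstance
    have hES := hE.inter (measurable_fieldOn hA hS)
    set Z := slice g a β h ξ b A 1 with hZ
    set I := slice g a β h ξ b A (E.indicator 1) with hI
    have mZ : Measurable Z := measurable_slice hg a β h ξ b A measurable_one
    have mI : Measurable I := measurable_slice hg a β h ξ b A (measurable_one.indicator hE)
    -- The conditional probability of E, cut off to S. Disintegrating both sides leaves I = (Z⁻¹ I)
    -- Z on S, valid because Z is positive and finite at every value of s|_A.
    set u : (A → ℝ≥0) → ℝ≥0∞ := S.indicator fun t => (Z t)⁻¹ * I t with hu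
    have mu : Measurable u := (mZ.inv.mul mI).indicator hS
    have hL := lintegral_mul_fieldOn hg a β h ξ b hA η (measurable_one.indicator hS)
      (measurable_one.indicator hE) fun _ => false
    have hR := lintegral_mul_fieldOn hg a β h ξ b hA η mu
      (Φ := 1) measurable_one fun _ => false
    rw [phi4RC_eq g a β h ξ b η]
    have e : phi4RCGiven g a β h ξ b ∅ η = (rawMeasure g a β h ξ b ∅ η Set.univ)⁻¹ •
      rawMeasure g a β h ξ b ∅ η := rfl
    rw [← lintegral_indicator (measurable_fieldOn hA hS), ← lintegral_indicator_one hES, e,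
      lintegral_smul_measure, lintegral_smul_measure]
    congr 1
    calc _ = ∫⁻ q, S.indicator 1 (fieldOn hA q) * E.indicator 1 q
          ∂rawMeasure g a β h ξ b ∅ η := by
          refine lintegral_congr fun q => ?_
          by_cases h1 : q ∈ E <;> by_cases h2 : fieldOn hA q ∈ S <;> simp [h1, h2]
      _ = ∫⁻ q, u (fieldOn hA q) * (1 : Config Λ × AbsField Λ → ℝ≥0∞) q
          ∂rawMeasure g a β h ξ b ∅ η := by
          rw [hL, hR]
          refine lintegral_congr fun s => ?_
          have z0 : Z (fieldOn hA (fun _ => false, s)) ≠ 0 := by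
            simpa [hZ, slice] using rawMeasure_univ_ne_zero hg a β h ξ b A _
          have zt : Z (fieldOn hA (fun _ => false, s)) ≠ ∞ := by
            simpa [hZ, slice] using rawMeasure_univ_ne_top hg a h ξ b A _ hβ
          rw [← hI, ← hZ, hu]
          by_cases h2 : fieldOn hA (fun _ => false, s) ∈ S
          · simp only [h2, Set.indicator_of_mem, Pi.one_apply, one_mul]
            rw [mul_comm, ← mul_assoc, ENNReal.mul_inv_cancel z0 zt, one_mul]
          · simp [h2]
      _ = _ := by
          refine lintegral_congr fun q => ?_
          by_cases h2 : fieldOn hA q ∈ S <;>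
            simp [hu, h2, phi4RCGiven_apply a β h ξ b A _ hE, hZ, hI]

end Disintegration

end Main

end Phi4RC

theorem mainTheorem11 {d : ℕ} (g a : ℝ) (hg : 0 < g) (Λ : Finset (Fin d → ℤ)) :
    (∀ (β : ℝ) (h : Λ → ℝ≥0) (ξ : Setoid (Phi4RC.extBoundary Λ))
        (b : Phi4RC.extBoundary Λ → ℝ≥0), 0 ≤ β →
      IsProbabilityMeasure (Phi4RC.phi4RC g a β h ξ b) ∧
      Phi4RC.HasFKG (Phi4RC.phi4RC g a β h ξ b) ∧
      ∀ (A : Finset (Fin d → ℤ)) (hA : A ⊆ Λ),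
        Phi4RC.IsRegularCondLaw (Phi4RC.phi4RC g a β h ξ b) (Phi4RC.fieldOn hA)
          (Phi4RC.phi4RCGiven g a β h ξ b A) ∧
        ∀ η : A → ℝ≥0, Phi4RC.HasFKG (Phi4RC.phi4RCGiven g a β h ξ b A η)) ∧
    (∀ (β₁ β₂ : ℝ) (h₁ h₂ : Λ → ℝ≥0) (ξ₁ ξ₂ : Setoid (Phi4RC.extBoundary Λ))
        (b₁ b₂ : Phi4RC.extBoundary Λ → ℝ≥0),
      0 ≤ β₁ → β₁ ≤ β₂ → h₁ ≤ h₂ → ξ₁ ≤ ξ₂ → b₁ ≤ b₂ →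
      Phi4RC.StochDom (Phi4RC.phi4RC g a β₁ h₁ ξ₁ b₁) (Phi4RC.phi4RC g a β₂ h₂ ξ₂ b₂) ∧
      ∀ A : Finset (Fin d → ℤ), A ⊆ Λ → ∀ η₁ η₂ : A → ℝ≥0, η₁ ≤ η₂ →
        Phi4RC.StochDom (Phi4RC.phi4RCGiven g a β₁ h₁ ξ₁ b₁ A η₁)
          (Phi4RC.phi4RCGiven g a β₂ h₂ ξ₂ b₂ A η₂)) := by
  have h0 : Nonempty ((∅ : Finset (Fin d → ℤ)) → ℝ≥0) := inferInstance
  obtain ⟨η₀⟩ := h0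
  constructor
  · intro β h ξ b hβ
    have hp := fun A η => Phi4RC.isProbabilityMeasure_phi4RCGiven hg a h ξ b A η hβ
    have hc := fun (A : Finset (Fin d → ℤ)) (η : A → ℝ≥0) =>
      (Phi4RC.correlated_phi4RCGiven hg a hβ le_rfl (le_refl h) (le_refl ξ) (le_refl b) A
        (le_refl η)).hasFKG
    have e := Phi4RC.phi4RC_eq g a β h ξ b η₀
    refine ⟨?_, ?_, fun A hA => ⟨Phi4RC.isRegularCondLaw_phi4RCGiven hg a h ξ b hβ hA, hc A⟩⟩
    · rw [e]
      exact hp ∅ η₀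
    · rw [e]
      exact hc ∅ η₀
  · intro β₁ β₂ h₁ h₂ ξ₁ ξ₂ b₁ b₂ hβ₁ hβ hh hξ hb
    have key : ∀ (A : Finset (Fin d → ℤ)) (η₁ η₂ : A → ℝ≥0), η₁ ≤ η₂ →
        Phi4RC.StochDom (Phi4RC.phi4RCGiven g a β₁ h₁ ξ₁ b₁ A η₁)
          (Phi4RC.phi4RCGiven g a β₂ h₂ ξ₂ b₂ A η₂) := fun A η₁ η₂ hη =>
      have := Phi4RC.isProbabilityMeasure_phi4RCGiven hg a h₁ ξ₁ b₁ A η₁ hβ₁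
      have := Phi4RC.isProbabilityMeasure_phi4RCGiven hg a h₂ ξ₂ b₂ A η₂ (hβ₁.trans hβ)
      (Phi4RC.correlated_phi4RCGiven hg a hβ₁ hβ hh hξ hb A hη).stochDom
    refine ⟨?_, fun A _ => key A⟩
    rw [Phi4RC.phi4RC_eq g a β₁ h₁ ξ₁ b₁ η₀, Phi4RC.phi4RC_eq g a β₂ h₂ ξ₂ b₂ η₀]
    exact key ∅ η₀ η₀ le_rfl
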